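/- Let $\Omega\subset\mathbb R^n$ be open, and let $C^1_0(\Omega,\mathbb R^n)$ be the space of $C^1$ vector fields $u$ on $\Omega$ such that $u$ and $Du$ vanish at $\partial\Omega$ and at infinity. Let $V\subset C^1_0(\Omega,\mathbb R^n)$ be an admissible Hilbert space, i.e. $\|u\|_\infty+\|Du\|_\infty\le C\|u\|_V$ for all $u\in V$, with a constant $C>0$. For $v\in L^2([0,1],V)$ let $\varphi^v_t$ be its flow: $\varphi^v_t$ is a $C^1$-diffeomorphism of $\Omega$ with $\partial_t\varphi^v_t(x)=v(t,\varphi^v_t(x))$, $\varphi^v_0(x)=x$. Let $X\subset C^1(\Omega)$ be a vector space of real functions (images), let $Y$ be a data space, and let $D:Y\times Y\to[0,\infty)$, $\mathcal T_t: X\to Y$, $g(t)\in Y$ ($t\in[0,1]$), $R_1:X\to[0,\infty)$ and $\mu_1,\mu_2\ge 0$ be arbitrary. For an action $\varphi . T$ of diffeomorphisms on images consider the joint model $$\text{(P)}\quad \min_{T\in X,\;v\in L^2([0,1],V)}\ \int_0^1\Bigl[D\bigl(\mathcal T_t(\varphi^v_t . T),g(t)\bigr)+\mu_2\int_0^t\|v(\tau,\cdot)\|_V^2\,d\tau\Bigr]dt+\mu_1R_1(T),$$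 where $\varphi^v$ is the flow of $v$, and the PDE-constrained problem $$\text{(Q)}\quad \min_{f,\;v\in L^2([0,1],V)}\ \int_0^1\Bigl[D\bigl(\mathcal T_t(f(t,\cdot)),g(t)\bigr)+\mu_2\int_0^t\|v(\tau,\cdot)\|_V^2\,d\tau\Bigr]dt+\mu_1R_1\bigl(f(0,\cdot)\bigr),$$ over $f:[0,1]\times\Omega\to\mathbb R$ with $f(t,\cdot)\in X$ for all $t$ and with $f$ and $\nabla f$ (the spatial gradient) continuous on $[0,1]\times\Omega$, subject to a partial differential equation for $(f,v)$. Objectives take values in $[0,\infty]$, with value $\infty$ if the data term is not measurable in $t$. Since $v$ is only square integrable in time, all time derivatives are understood in the Carathéodory (time-integrated) sense: $\partial_t w=h$ means $w(t)=w(0)+\int_0^t h(s)\,ds$ for all $t\in[0,1]$ with $h$ integrable, for each fixed $x\in\Omega$. Then each $v\in L^2([0,1],V)$ has exactly one flow $\varphi^v$, and the following hold. 1. (Geometric action, $\varphi . T=T\circ\varphi^{-1}$.) Suppose that $\varphi^v_t . T\in X$ for all $T\in X$, $v\in L^2([0,1],V)$, $t\in[0,1]$. Then (P) is equivalent to (Q)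 with the transport (optical-flow) equation $\partial_tf+\langle\nabla f,v\rangle=0$. 2. (Mass-preserving action, $\varphi . T=|D(\varphi^{-1})|\;T\circ\varphi^{-1}$, where $|D(\varphi^{-1})|$ is the determinant of the Jacobian of $\varphi^{-1}$.) Suppose that for all $T\in X$ and $v\in L^2([0,1],V)$ the trajectory $f(t,\cdot)=\varphi^v_t . T$ lies in $X$ for all $t\in[0,1]$ and that $f$ and $\nabla f$ are continuous on $[0,1]\times\Omega$. Then (P) is equivalent to (Q) with the continuity equation $\partial_tf+\nabla\cdot(f\,v)=0$. Here "equivalent" means: the map $(T,v)\mapsto(f,v)$ with $f(t,\cdot)=\varphi^v_t . T$ is a bijection from the feasible points of (P) onto those of (Q), with $f(0,\cdot)=T$; it preserves the objective; the optimal values of (P) and (Q) coincide; if $(T,v)$ is a minimizer of (P) then $(f,v)$ is a minimizer of (Q); and if $(f,v)$ is a minimizer of (Q) then $(f(0,\cdot),v)$ is a minimizer of (P) and $f(t,\cdot)=\varphi^v_t . f(0,\cdot)$ for all $t$. -/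

import Mathlib

open MeasureTheory Set Filter Topology
open scoped ENNReal NNReal unitInterval

noncomputable section

namespace LDDMM

/-- The space `ℝⁿ` with its Euclidean structure. -/
abbrev Euc (n : ℕ) : Type := EuclideanSpace ℝ (Fin n)

variable {n : ℕ} {Ω : TopologicalSpace.Opens (Euc n)}

/-! ### Calculus on an open set -/

open Classical in
/-- Extension by zero of a map on `Ω`. It is only ever differentiated at points of the open set
`Ω`, where the choice of the extension is irrelevant. -/
def extendZero {F : Type*} [Zero F] (u : Ω → F) : Euc n → F :=
  fun x => if h : x ∈ Ω then u ⟨x, h⟩ else 0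

/-- The derivative at `x ∈ Ω` of a map on `Ω`. -/
def jac {F : Type*} [NormedAddCommGroup F] [NormedSpace ℝ F] (u : Ω → F) (x : Ω) :
    Euc n →L[ℝ] F :=
  fderiv ℝ (extendZero u) x

/-- `u` is continuously differentiable on `Ω`. -/
def IsC1 {F : Type*} [NormedAddCommGroup F] [NormedSpace ℝ F] (u : Ω → F) : Prop :=
  ContDiffOn ℝ 1 (extendZero u) Ω

/-- The gradient at `x ∈ Ω` of a real function on `Ω`. -/
def grad (f : Ω → ℝ) (x : Ω) : Euc n := gradient (extendZero f) x

/-- The divergence at `x ∈ Ω` of a vector field on `Ω`: the trace of its Jacobian. -/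
def divergence (u : Ω → Euc n) (x : Ω) : ℝ :=
  LinearMap.trace ℝ (Euc n) (jac u x : Euc n →ₗ[ℝ] Euc n)

/-- `u ∈ C¹₀(Ω, ℝⁿ)`: `u` is continuously differentiable, and `u` and `Du` vanish at the boundary
of `Ω` and at infinity, i.e. they are small off compact subsets of `Ω`. -/
def IsC1Zero (u : Ω → Euc n) : Prop :=
  IsC1 u ∧ Tendsto u (cocompact Ω) (𝓝 0) ∧ Tendsto (jac u) (cocompact Ω) (𝓝 0)

/-! ### Velocity fields, diffeomorphisms and flows -/

section Velocity

variable {V : Type*} [NormedAddCommGroup V] [InnerProductSpace ℝ V]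

/-- The inner product space `V`, regarded as a space of vector fields on `Ω` through the injective
linear map `ev`, is contained in `C¹₀(Ω, ℝⁿ)`, and the inclusion is bounded:
`‖u‖_∞ + ‖Du‖_∞ ≤ C ‖u‖_V`. -/
structure IsAdmissible (ev : V →ₗ[ℝ] (Ω → Euc n)) : Prop where
  injective : Function.Injective ev
  isC1Zero : ∀ u : V, IsC1Zero (ev u)
  bound : ∃ C : ℝ, 0 < C ∧ ∀ (u : V) (x y : Ω), ‖ev u x‖ + ‖jac (ev u) y‖ ≤ C * ‖u‖

/-- The space `L²([0,1], V)` of time-dependent velocity fields. -/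
abbrev Velocity (V : Type*) [NormedAddCommGroup V] : Type _ :=
  Lp V 2 (volume : Measure I)

/-- A `C¹`-diffeomorphism of `Ω` onto itself. -/
structure Diffeo (Ω : TopologicalSpace.Opens (Euc n)) where
  toEquiv : Ω ≃ Ω
  isC1 : IsC1 (fun x => (toEquiv x : Euc n))
  isC1_symm : IsC1 (fun x => (toEquiv.symm x : Euc n))

/-- `φ` is the flow of the velocity field `v`: it solves `∂ₜ φₜ(x) = v(t, φₜ(x))`, `φ₀(x) = x` on
`[0,1]` in the Carathéodory sense (`v` is only square integrable in time), that is
`φₜ(x) = x + ∫₀ᵗ v(s, φₛ(x)) ds`. -/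
def IsFlow (ev : V →ₗ[ℝ] (Ω → Euc n)) (v : Velocity V) (φ : I → Diffeo Ω) : Prop :=
  ∀ x : Ω, Integrable (fun s : I => ev (v s) ((φ s).toEquiv x)) ∧
    ∀ t : I, ((φ t).toEquiv x : Euc n) = x + ∫ s in Iic t, ev (v s) ((φ s).toEquiv x)

/-! ### Group actions -/

/-- The geometric action `φ . f = f ∘ φ⁻¹`. -/
def geometricAction (φ : Diffeo Ω) (f : Ω → ℝ) : Ω → ℝ :=
  fun x => f (φ.toEquiv.symm x)

/-- The mass-preserving action `φ . f = |D(φ⁻¹)| (f ∘ φ⁻¹)`, where `|D(φ⁻¹)|` is the determinant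
of the Jacobian of `φ⁻¹`. -/
def massAction (φ : Diffeo Ω) (f : Ω → ℝ) : Ω → ℝ :=
  fun x => (jac (fun y => (φ.toEquiv.symm y : Euc n)) x).det * f (φ.toEquiv.symm x)

/-- The image trajectory `f(t, ·) = φₜ . T` generated by a template `T`. -/
def orbit (act : Diffeo Ω → (Ω → ℝ) → (Ω → ℝ)) (T : Ω → ℝ) (φ : I → Diffeo Ω) : I → Ω → ℝ :=
  fun t => act (φ t) T

/-! ### The partial differential equations -/

/-- `f` and its spatial gradient `∇f` are continuous on `[0,1] × Ω`. -/
def IsC1Trajectory (f : I → Ω → ℝ) : Prop :=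
  Continuous (fun p : I × Ω => f p.1 p.2) ∧ Continuous (fun p : I × Ω => grad (f p.1) p.2)

/-- The transport (optical flow) equation `∂ₜ f + ⟨∇f, v⟩ = 0` on `[0,1] × Ω`, where the time
derivative is taken in the Carathéodory sense:
`f(t,x) = f(0,x) - ∫₀ᵗ ⟨∇f(s,x), v(s,x)⟩ ds`. -/
def TransportEquation (ev : V →ₗ[ℝ] (Ω → Euc n)) (f : I → Ω → ℝ) (v : Velocity V) : Prop :=
  ∀ x : Ω, Integrable (fun s : I => inner ℝ (grad (f s) x) (ev (v s) x)) ∧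
    ∀ t : I, f t x = f 0 x - ∫ s in Iic t, inner ℝ (grad (f s) x) (ev (v s) x)

/-- The continuity equation `∂ₜ f + ∇·(f v) = 0` on `[0,1] × Ω`, where the time derivative is taken
in the Carathéodory sense: `f(t,x) = f(0,x) - ∫₀ᵗ ∇·(f(s,·) v(s,·))(x) ds`. -/
def ContinuityEquation (ev : V →ₗ[ℝ] (Ω → Euc n)) (f : I → Ω → ℝ) (v : Velocity V) : Prop :=
  ∀ x : Ω, Integrable (fun s : I => divergence (fun y => f s y • ev (v s) y) x) ∧
    ∀ t : I, f t x = f 0 x - ∫ s in Iic t, divergence (fun y => f s y • ev (v s) y) x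

/-! ### The two minimization problems -/

/-- A minimization problem: minimize `objective` over `feasible`. -/
structure MinProblem (α : Type*) where
  feasible : Set α
  objective : α → ℝ≥0∞

/-- `a` is a solution (a minimizer) of the problem `P`. -/
def MinProblem.IsSolution {α : Type*} (P : MinProblem α) (a : α) : Prop :=
  a ∈ P.feasible ∧ ∀ b ∈ P.feasible, P.objective a ≤ P.objective b

/-- The infimum of the objective of `P`. -/
def MinProblem.value {α : Type*} (P : MinProblem α) : ℝ≥0∞ :=
  ⨅ a ∈ P.feasible, P.objective a

variable {Y : Type*}

open Classical in
/-- The functional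
`∫₀¹ [D(Aₜ(f(t,·)), g(t)) + μ₂ ∫₀ᵗ ‖v(τ,·)‖²_V dτ] dt + μ₁ R₁(T)` with values in `[0,∞]`; it is
`∞` when the data term is not a measurable function of time. -/
def functional (D : Y → Y → ℝ≥0) (A : I → (Ω → ℝ) → Y) (g : I → Y) (R₁ : (Ω → ℝ) → ℝ≥0)
    (μ₁ μ₂ : ℝ≥0) (f : I → Ω → ℝ) (T : Ω → ℝ) (v : Velocity V) : ℝ≥0∞ :=
  if AEMeasurable (fun t : I => D (A t (f t)) (g t)) then
    (∫⁻ t : I, ((D (A t (f t)) (g t) : ℝ≥0∞) + μ₂ * ∫⁻ τ in Iic t, ‖v τ‖ₑ ^ 2)) + μ₁ * R₁ T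
  else ∞

/-- The joint model: minimize the functional of the trajectory `φₜ . T` and of `T` over templates
`T ∈ X` and velocity fields `v ∈ L²([0,1], V)`, subject to `φ` being the flow of `v`. -/
def jointModel (ev : V →ₗ[ℝ] (Ω → Euc n)) (X : Submodule ℝ (Ω → ℝ))
    (D : Y → Y → ℝ≥0) (A : I → (Ω → ℝ) → Y) (g : I → Y) (R₁ : (Ω → ℝ) → ℝ≥0) (μ₁ μ₂ : ℝ≥0)
    (act : Diffeo Ω → (Ω → ℝ) → (Ω → ℝ)) :
    MinProblem ((Ω → ℝ) × Velocity V × (I → Diffeo Ω)) where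
  feasible := {p | p.1 ∈ X ∧ IsFlow ev p.2.1 p.2.2}
  objective p := functional D A g R₁ μ₁ μ₂ (orbit act p.1 p.2.2) p.1 p.2.1

/-- The PDE-constrained problem: minimize the functional of the trajectory `f` and of `f(0,·)` over
trajectories `f` in `X`, with `f` and `∇f` continuous on `[0,1] × Ω`, and velocity fields
`v ∈ L²([0,1], V)`, subject to the equation `pde f v`. -/
def pdeProblem (X : Submodule ℝ (Ω → ℝ))
    (D : Y → Y → ℝ≥0) (A : I → (Ω → ℝ) → Y) (g : I → Y) (R₁ : (Ω → ℝ) → ℝ≥0) (μ₁ μ₂ : ℝ≥0)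
    (pde : (I → Ω → ℝ) → Velocity V → Prop) :
    MinProblem ((I → Ω → ℝ) × Velocity V) where
  feasible := {q | (∀ t, q.1 t ∈ X) ∧ IsC1Trajectory q.1 ∧ pde q.1 q.2}
  objective q := functional D A g R₁ μ₁ μ₂ q.1 (q.1 0) q.2

/-- The joint model `P` (in `(T, v, φ)`) and the PDE-constrained problem `Q` (in `(f, v)`) are
equivalent through `f(t,·) = φₜ . T`, `T = f(0,·)`. -/
structure AreEquivalent (act : Diffeo Ω → (Ω → ℝ) → (Ω → ℝ))
    (P : MinProblem ((Ω → ℝ) × Velocity V × (I → Diffeo Ω)))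
    (Q : MinProblem ((I → Ω → ℝ) × Velocity V)) : Prop where
  /-- `(T, v, φ) ↦ (f, v)` is a bijection between the feasible points. -/
  bijOn : BijOn (fun p => (orbit act p.1 p.2.2, p.2.1)) P.feasible Q.feasible
  /-- It preserves the objective, and `f(0,·) = T`. -/
  objective_eq : ∀ T v φ, (T, v, φ) ∈ P.feasible →
    orbit act T φ 0 = T ∧ Q.objective (orbit act T φ, v) = P.objective (T, v, φ)
  /-- The optimal values agree. -/
  value_eq : P.value = Q.value
  /-- A solution of `P` generates a solution of `Q`. -/
  solution_left : ∀ T v φ, P.IsSolution (T, v, φ) → Q.IsSolution (orbit act T φ, v)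
  /-- A solution of `Q` generates a solution of `P`, with template `f(0,·)`. -/
  solution_right : ∀ f v, Q.IsSolution (f, v) →
    ∃ φ, P.IsSolution (f 0, v, φ) ∧ f = orbit act (f 0) φ

end Velocity

end LDDMM

end

open LDDMM

noncomputable section

namespace LDDMM

/-! ### Additive estimates and primitives -/

section Primitive

variable {F G : Type*} [NormedAddCommGroup F] [NormedAddCommGroup G]

/-! The proof is the method of characteristics. Both equations have the form `∂ₜf + ⟨∇f, v⟩ + f
q(Dv) = 0` with a linear functional `q` of the Jacobian: `q = 0` for transport, the trace for
continuity. Along a trajectory the equation becomes a scalar linear ODE, so a `C¹` trajectory `f`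
solves it iff `f(t, φₜ(y)) = f(0, y) exp(-∫₀ᵗ q(Dv)(φᵣ(y)) dr)` (`firstOrderEquation_iff`). For `q =
0` this is the geometric action on `f(0,·)`; for the trace, Liouville's formula (`det_flowDeriv`)
identifies the exponential with `det D(φₜ⁻¹)` at `φₜ(y)`, which is the mass-preserving action. Thus
the feasible `f` are exactly the orbits, and the equivalence of the two problems is formal
(`areEquivalent`).

Two analytic points carry the argument. First, since `u` and `Du` vanish at the boundary, the
extension of `u` by zero is `C¹` on the whole space (`IsC1Zero.hasFDerivAt_extendZero`). The flow is
therefore global; it fixes the complement of `Ω`, hence preserves `Ω`.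

Second, `v` is only integrable in time, so the classical chain rule does not apply to `f(t, φₜ(y))`.
Instead, a function is shown to be constant by bounding its short increments by integrals of
densities of arbitrarily small mass (`eq_of_local_increments`). The densities come from a common
modulus of continuity of the `Dv(t)` (`exists_fderiv_modulus`), and `exists_increment_le` is the
resulting substitute for the chain rule, used in both directions. -/

theorem norm_sub_le_integral_of_local {f : ℝ → F} {k : ℝ → ℝ} {a b δ : ℝ} (hab : a ≤ b)
    (hδ : 0 < δ) (hk : Integrable k)
    (h : ∀ s t, a ≤ s → s ≤ t → t ≤ b → t - s ≤ δ → ‖f t - f s‖ ≤ ∫ r in s..t, k r) :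
    ‖f b - f a‖ ≤ ∫ r in a..b, k r := by
  -- `m` counts the steps of length `δ` needed to reach `t`; the increments add up.
  have key : ∀ m : ℕ, ∀ t, a ≤ t → t ≤ b → t - a ≤ m * δ → ‖f t - f a‖ ≤ ∫ r in a..t, k r := by
    intro m
    induction m with
    | zero =>
      intro t hat _ hm
      have : t = a := by
        simp only [Nat.cast_zero, zero_mul] at hm
        linarith
      subst this
      simp
    | succ m ih =>
      intro t hat htb hm
      push_cast at hm
      rcases le_total (t - a) δ with hle | hle
      · exact h a t le_rfl hat htb hle
      have h1 := ih (t - δ) (by linarith) (by linarith) (by linarith)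
      have h2 := h (t - δ) t (by linarith) (by linarith) htb (by linarith)
      rw [← intervalIntegral.integral_add_adjacent_intervals (b := t - δ)
        hk.intervalIntegrable hk.intervalIntegrable]
      calc ‖f t - f a‖ = ‖(f (t - δ) - f a) + (f t - f (t - δ))‖ := by congr 1; abel
        _ ≤ _ := (norm_add_le _ _).trans (add_le_add h1 h2)
  obtain ⟨m, hm⟩ := exists_nat_ge ((b - a) / δ)
  exact key m b hab le_rfl ((div_le_iff₀ hδ).1 hm)

theorem intervalIntegral_le_integral {k : ℝ → ℝ} (hk : Integrable k) (hk0 : ∀ r, 0 ≤ k r) {s t : ℝ}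
    (hst : s ≤ t) : ∫ r in s..t, k r ≤ ∫ r, k r := by
  rw [intervalIntegral.integral_of_le hst]
  exact setIntegral_le_integral hk (Eventually.of_forall hk0)

theorem abs_intervalIntegral_le_integral {k : ℝ → ℝ} (hk : Integrable k) (hk0 : ∀ r, 0 ≤ k r)
    (s t : ℝ) : |∫ r in s..t, k r| ≤ ∫ r, k r := by
  wlog hst : s ≤ t generalizing s t
  · rw [intervalIntegral.integral_symm, abs_neg]
    exact this t s (le_of_not_ge hst)
  rw [abs_of_nonneg (intervalIntegral.integral_nonneg hst fun r _ => hk0 r)]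
  exact intervalIntegral_le_integral hk hk0 hst

/-- A map whose small increments are dominated by integrals of arbitrarily small mass is
constant. -/
theorem eq_of_local_increments {f : ℝ → F} {a b : ℝ} (hab : a ≤ b)
    (h : ∀ ε > 0, ∃ δ > 0, ∃ k : ℝ → ℝ, Integrable k ∧ (∀ r, 0 ≤ k r) ∧ ∫ r, k r ≤ ε ∧
      ∀ s t, a ≤ s → s ≤ t → t ≤ b → t - s ≤ δ → ‖f t - f s‖ ≤ ∫ r in s..t, k r) :
    f b = f a := by
  rw [← sub_eq_zero, ← norm_le_zero_iff]
  refine le_of_forall_pos_le_add fun ε hε => ?_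
  obtain ⟨δ, hδ, k, hk, hk0, hkε, hinc⟩ := h ε hε
  rw [zero_add]
  exact (norm_sub_le_integral_of_local hab hδ hk hinc).trans
    ((intervalIntegral_le_integral hk hk0 hab).trans hkε)

variable [NormedSpace ℝ F] [NormedSpace ℝ G]

/-- `γ` is a primitive of the integrable map `g`: `γ' = g` in the Carathéodory sense. -/
def IsPrimitive (γ g : ℝ → F) : Prop :=
  Integrable g ∧ ∀ s t, γ t - γ s = ∫ r in s..t, g r

theorem isPrimitive_of_eq {γ g : ℝ → F} (hg : Integrable g) {x : F} {t₀ : ℝ}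
    (h : ∀ t, γ t = x + ∫ r in t₀..t, g r) : IsPrimitive γ g := by
  refine ⟨hg, fun s t => ?_⟩
  rw [h, h, add_sub_add_left_eq_sub, intervalIntegral.integral_interval_sub_left
    hg.intervalIntegrable hg.intervalIntegrable]

theorem isPrimitive_integral {g : ℝ → F} (hg : Integrable g) (t₀ : ℝ) :
    IsPrimitive (fun t => ∫ r in t₀..t, g r) g :=
  isPrimitive_of_eq hg (x := 0) (t₀ := t₀) fun t => by simp

namespace IsPrimitive

variable {γ g : ℝ → F}

theorem eq_add (h : IsPrimitive γ g) (s t : ℝ) : γ t = γ s + ∫ r in s..t, g r := by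
  rw [← h.2 s t]; abel

theorem continuous (h : IsPrimitive γ g) : Continuous γ := by
  have : γ = fun t => γ 0 + ∫ r in (0 : ℝ)..t, g r := funext fun t => h.eq_add 0 t
  rw [this]
  exact continuous_const.add
    (intervalIntegral.continuous_primitive (fun a b => h.1.intervalIntegrable) 0)

theorem norm_sub_le (h : IsPrimitive γ g) {k : ℝ → ℝ} (hk : Integrable k)
    (hgk : ∀ r, ‖g r‖ ≤ k r) (s t : ℝ) : ‖γ t - γ s‖ ≤ |∫ r in s..t, k r| := by
  rw [h.2]
  exact intervalIntegral.norm_integral_le_abs_of_norm_le (Eventually.of_forall hgk)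
    hk.intervalIntegrable

theorem norm_le (h : IsPrimitive γ g) (t : ℝ) : ‖γ t‖ ≤ ‖γ 0‖ + ∫ r, ‖g r‖ := by
  have h1 := h.norm_sub_le h.1.norm (fun _ => le_rfl) 0 t
  have h2 := abs_intervalIntegral_le_integral h.1.norm (fun _ => norm_nonneg _) 0 t
  have h3 := norm_le_norm_add_norm_sub (γ 0) (γ t)
  rw [norm_sub_rev] at h3
  linarith

/-- The chain rule for primitives. -/
theorem comp_contDiff [ProperSpace F] [CompleteSpace G] (h : IsPrimitive γ g) {f : F → G}
    (hf : ContDiff ℝ 1 f) :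
    IsPrimitive (fun t => f (γ t)) (fun t => fderiv ℝ f (γ t) (g t)) := by
  have hf' : Continuous (fderiv ℝ f) := hf.continuous_fderiv one_ne_zero
  have hdf : ∀ x, HasFDerivAt f (fderiv ℝ f x) x := fun x =>
    (hf.differentiable one_ne_zero x).hasFDerivAt
  set R := ‖γ 0‖ + ∫ r, ‖g r‖ with hR
  have hball : ∀ t, γ t ∈ Metric.closedBall (0 : F) R := fun t => by
    simpa using h.norm_le t
  have hK : IsCompact (Metric.closedBall (0 : F) R) := isCompact_closedBall _ _
  obtain ⟨M, hM⟩ := hK.exists_bound_of_continuousOn hf'.continuousOn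
  have hint : Integrable (fun t => fderiv ℝ f (γ t) (g t)) := by
    refine (h.1.norm.const_mul M).mono' ?_ (Eventually.of_forall fun t => ?_)
    · exact (ContinuousLinearMap.apply ℝ G (E := F)).flip.aestronglyMeasurable_comp₂
        ((hf'.comp h.continuous).aestronglyMeasurable) h.1.aestronglyMeasurable
    · exact ((fderiv ℝ f (γ t)).le_opNorm _).trans
        (mul_le_mul_of_nonneg_right (hM _ (hball t)) (norm_nonneg _))
  refine ⟨hint, ?_⟩
  have key : ∀ a b, a ≤ b → f (γ b) - f (γ a) = ∫ r in a..b, fderiv ℝ f (γ r) (g r) := by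
    intro a b hab
    have := eq_of_local_increments
      (f := fun t => f (γ t) - ∫ r in a..t, fderiv ℝ f (γ r) (g r)) hab ?_
    · simp only [intervalIntegral.integral_same, sub_zero] at this
      rw [← this]; abel
    intro ε hε
    set N := ∫ r, ‖g r‖ with hN
    have hN0 : 0 ≤ N := integral_nonneg fun _ => norm_nonneg _
    -- The increments will be dominated by `2 η ‖g‖`: one `η` from the first-order remainder of `f`,
    -- one from freezing `fderiv ℝ f` at `γ s`. The `+ 1` avoids division by zero.
    set η := ε / (2 * (N + 1)) with hη
    have hη0 : 0 < η := by positivity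
    -- Only one of the two points has to lie in the compact ball, so the ball around `γ s` used
    -- below may stick out of it.
    obtain ⟨δ, hδ, hδ'⟩ := Metric.mem_uniformity_dist.1
      (hK.uniformContinuousAt_of_continuousAt (fderiv ℝ f) (fun x _ => hf'.continuousAt)
        (Metric.dist_mem_uniformity hη0))
    have hunif : UniformContinuousOn γ (Icc a b) :=
      isCompact_Icc.uniformContinuousOn_of_continuous h.continuous.continuousOn
    obtain ⟨τ, hτ, hτ'⟩ := Metric.uniformContinuousOn_iff.1 hunif δ hδ
    refine ⟨τ / 2, by positivity, fun r => 2 * η * ‖g r‖, h.1.norm.const_mul _,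
      fun r => by positivity, ?_, ?_⟩
    · rw [integral_const_mul, ← hN, hη]
      have : 2 * (ε / (2 * (N + 1))) * N = ε * (N / (N + 1)) := by field_simp
      rw [this]
      exact mul_le_of_le_one_right hε.le ((div_le_one (by linarith)).2 (by linarith))
    intro s t has hst htb hts
    have hnear : ∀ r ∈ Icc s t, dist (γ s) (γ r) < δ := fun r hr =>
      hτ' s ⟨has, hst.trans htb⟩ r ⟨has.trans hr.1, hr.2.trans htb⟩ (by
        rw [Real.dist_eq, abs_sub_comm, abs_of_nonneg (by linarith [hr.1])]
        linarith [hr.2])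
    have h1 : ‖f (γ t) - f (γ s) - fderiv ℝ f (γ s) (γ t - γ s)‖ ≤ η * ‖γ t - γ s‖ := by
      refine (convex_ball (γ s) δ).norm_image_sub_le_of_norm_hasFDerivWithin_le'
        (fun x _ => (hdf x).hasFDerivWithinAt) (fun x hx => ?_) (Metric.mem_ball_self hδ)
        (by rw [Metric.mem_ball, dist_comm]; exact hnear t ⟨hst, le_rfl⟩)
      rw [← dist_eq_norm, dist_comm]
      exact (hδ' (by rw [dist_comm]; exact hx) (hball s)).le
    have h2 : ‖γ t - γ s‖ ≤ ∫ r in s..t, ‖g r‖ := by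
      rw [h.2]; exact intervalIntegral.norm_integral_le_integral_norm hst
    have h3 : ‖fderiv ℝ f (γ s) (γ t - γ s) - ∫ r in s..t, fderiv ℝ f (γ r) (g r)‖
        ≤ ∫ r in s..t, η * ‖g r‖ := by
      rw [h.2, ← ContinuousLinearMap.intervalIntegral_comp_comm _ h.1.intervalIntegrable,
        ← intervalIntegral.integral_sub
          ((fderiv ℝ f (γ s)).integrable_comp h.1).intervalIntegrable hint.intervalIntegrable]
      refine intervalIntegral.norm_integral_le_of_norm_le hst (Eventually.of_forall fun r hr => ?_)
        (h.1.norm.const_mul η).intervalIntegrable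
      rw [← sub_apply]
      refine (ContinuousLinearMap.le_opNorm _ _).trans
        (mul_le_mul_of_nonneg_right ?_ (norm_nonneg _))
      rw [← dist_eq_norm]
      exact (hδ' (hnear r ⟨hr.1.le, hr.2⟩) (hball s)).le
    have h4 : (∫ r in a..t, fderiv ℝ f (γ r) (g r)) = (∫ r in a..s, fderiv ℝ f (γ r) (g r)) +
        ∫ r in s..t, fderiv ℝ f (γ r) (g r) :=
      (intervalIntegral.integral_add_adjacent_intervals hint.intervalIntegrable
        hint.intervalIntegrable).symm
    have h5 : (fun t => f (γ t) - ∫ r in a..t, fderiv ℝ f (γ r) (g r)) t -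
        (fun t => f (γ t) - ∫ r in a..t, fderiv ℝ f (γ r) (g r)) s =
        (f (γ t) - f (γ s) - fderiv ℝ f (γ s) (γ t - γ s)) +
        (fderiv ℝ f (γ s) (γ t - γ s) - ∫ r in s..t, fderiv ℝ f (γ r) (g r)) := by
      simp only [h4]; abel
    rw [h5]
    refine (norm_add_le _ _).trans ((add_le_add (h1.trans
      (mul_le_mul_of_nonneg_left h2 hη0.le)) h3).trans (le_of_eq ?_))
    rw [intervalIntegral.integral_const_mul, intervalIntegral.integral_const_mul]
    ring
  intro s t
  rcases le_total s t with hst | hst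
  · exact key s t hst
  · rw [intervalIntegral.integral_symm, ← key t s hst]; abel

end IsPrimitive

end Primitive

/-! ### Carathéodory differential equations -/

/-- The exponential weight `exp (2 |∫ ℓ|)` centred at the time `t₀`. -/
def weight (ℓ : ℝ → ℝ) (t₀ t : ℝ) : ℝ := Real.exp (2 * |∫ r in t₀..t, ℓ r|)

/-! ### Exponential weights and Grönwall's inequality -/

section Weight

variable {ℓ : ℝ → ℝ}

theorem weight_pos (t₀ t : ℝ) : 0 < weight ℓ t₀ t := Real.exp_pos _

theorem one_le_weight (t₀ t : ℝ) : 1 ≤ weight ℓ t₀ t := Real.one_le_exp (by positivity)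

theorem weight_le (hℓ : Integrable ℓ) (h0 : ∀ t, 0 ≤ ℓ t) (t₀ t : ℝ) :
    weight ℓ t₀ t ≤ Real.exp (2 * ∫ r, ℓ r) := by
  unfold weight
  have := abs_intervalIntegral_le_integral hℓ h0 t₀ t
  gcongr

theorem continuous_weight (hℓ : Integrable ℓ) (t₀ : ℝ) : Continuous (weight ℓ t₀) :=
  Real.continuous_exp.comp (continuous_const.mul (isPrimitive_integral hℓ t₀).continuous.abs)

theorem integrable_mul_weight (hℓ : Integrable ℓ) (h0 : ∀ t, 0 ≤ ℓ t) (t₀ : ℝ) :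
    Integrable (fun t => ℓ t * weight ℓ t₀ t) :=
  hℓ.mul_bdd (c := Real.exp (2 * ∫ r, ℓ r)) (continuous_weight hℓ t₀).aestronglyMeasurable
    (Eventually.of_forall fun t => by
      rw [Real.norm_eq_abs, abs_of_pos (weight_pos _ _)]; exact weight_le hℓ h0 t₀ t)

/-- Up to sign, `ℓ * weight` is half the derivative of the weight, so its integral is `(weight - 1)
/ 2`. The factor `2` in the exponent thus yields the contraction constant `1 / 2`. -/
theorem abs_integral_mul_weight_le (hℓ : Integrable ℓ) (h0 : ∀ t, 0 ≤ ℓ t) (t₀ t : ℝ) :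
    |∫ r in t₀..t, ℓ r * weight ℓ t₀ r| ≤ weight ℓ t₀ t / 2 := by
  -- `κ` is the sign of the primitive of `ℓ`, fixed on each side of `t₀`; it replaces the absolute
  -- value by a smooth function.
  have key : ∀ κ : ℝ, (∀ r ∈ uIcc t₀ t, |∫ x in t₀..r, ℓ x| = κ * ∫ x in t₀..r, ℓ x) →
      (κ = 1 ∨ κ = -1) → |∫ r in t₀..t, ℓ r * weight ℓ t₀ r| ≤ weight ℓ t₀ t / 2 := by
    intro κ hκ hκ'
    have hp := (isPrimitive_integral hℓ t₀).comp_contDiff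
      (f := fun y => Real.exp (2 * (κ * y)) / 2) (by fun_prop)
    have hd : ∀ y, fderiv ℝ (fun y => Real.exp (2 * (κ * y)) / 2) y =
        ContinuousLinearMap.toSpanSingleton ℝ (κ * Real.exp (2 * (κ * y))) := by
      intro y
      have : HasDerivAt (fun y => Real.exp (2 * (κ * y)) / 2) (κ * Real.exp (2 * (κ * y))) y := by
        have h1 : HasDerivAt (fun y : ℝ => 2 * (κ * y)) (2 * κ) y := by
          simpa [mul_assoc] using ((hasDerivAt_id y).const_mul (2 * κ))
        exact (h1.exp.div_const 2).congr_deriv (by ring)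
      exact this.hasFDerivAt.fderiv
    have h2 := hp.2 t₀ t
    simp only [hd, ContinuousLinearMap.toSpanSingleton_apply, smul_eq_mul,
      intervalIntegral.integral_same, mul_zero, Real.exp_zero] at h2
    have h3 : ∫ r in t₀..t, ℓ r * weight ℓ t₀ r =
        κ * ∫ r in t₀..t, ℓ r * (κ * Real.exp (2 * (κ * ∫ x in t₀..r, ℓ x))) := by
      rw [← intervalIntegral.integral_const_mul]
      refine intervalIntegral.integral_congr fun r hr => ?_
      simp only [weight, hκ r hr]
      rcases hκ' with rfl | rfl <;> ring
    rw [h3, ← h2, abs_mul]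
    have h4 : |κ| = 1 := by rcases hκ' with rfl | rfl <;> simp
    have h5 : Real.exp (2 * (κ * ∫ x in t₀..t, ℓ x)) = weight ℓ t₀ t := by
      rw [weight, hκ t right_mem_uIcc]
    rw [h4, h5, one_mul, abs_of_nonneg]
    · linarith
    · linarith [one_le_weight (ℓ := ℓ) t₀ t]
  rcases le_total t₀ t with h | h
  · refine key 1 (fun r hr => ?_) (Or.inl rfl)
    rw [uIcc_of_le h] at hr
    rw [one_mul, abs_of_nonneg (intervalIntegral.integral_nonneg hr.1 fun r _ => h0 r)]
  · refine key (-1) (fun r hr => ?_) (Or.inr rfl)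
    rw [uIcc_of_ge h] at hr
    rw [neg_one_mul, abs_of_nonpos]
    rw [intervalIntegral.integral_symm, neg_nonpos]
    exact intervalIntegral.integral_nonneg hr.2 fun r _ => h0 r

/-- The Lipschitz constant of the flow of a vector field that is `ℓ t`-Lipschitz at time `t`. -/
def flowConst (ℓ : ℝ → ℝ) : ℝ := 2 * Real.exp (2 * ∫ r, ℓ r)

theorem flowConst_pos (ℓ : ℝ → ℝ) : 0 < flowConst ℓ := by unfold flowConst; positivity

/-- Grönwall's inequality for bounded functions. -/
theorem gronwall (hℓ : Integrable ℓ) (h0 : ∀ t, 0 ≤ ℓ t) {u : ℝ → ℝ} {a B t₀ : ℝ}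
    (hu0 : ∀ t, 0 ≤ u t) (huB : ∀ t, u t ≤ B) (ha : 0 ≤ a)
    (hu : ∀ t, u t ≤ a + |∫ r in t₀..t, ℓ r * u r|) (t : ℝ) : u t ≤ flowConst ℓ * a := by
  -- Boundedness of `u` makes this weighted supremum finite. The weight turns the integral term into
  -- `M / 2`, so `M ≤ a + M / 2` and `M ≤ 2 * a`.
  set M := ⨆ t, u t / weight ℓ t₀ t with hM
  have hbdd : BddAbove (range fun t => u t / weight ℓ t₀ t) := by
    refine ⟨B, ?_⟩
    rintro _ ⟨t, rfl⟩
    exact (div_le_self (hu0 t) (one_le_weight _ _)).trans (huB t)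
  have hle : ∀ t, u t ≤ M * weight ℓ t₀ t := fun t =>
    (div_le_iff₀ (weight_pos _ _)).1 (le_ciSup hbdd t)
  have hM0 : 0 ≤ M := (div_nonneg (hu0 t) (weight_pos t₀ t).le).trans (le_ciSup hbdd t)
  have hM' : M ≤ a + M / 2 := by
    refine ciSup_le fun s => (div_le_iff₀ (weight_pos _ _)).2 ?_
    have h1 : |∫ r in t₀..s, ℓ r * u r| ≤ |∫ r in t₀..s, M * (ℓ r * weight ℓ t₀ r)| := by
      rw [← Real.norm_eq_abs (∫ r in t₀..s, ℓ r * u r)]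
      refine intervalIntegral.norm_integral_le_abs_of_norm_le (Eventually.of_forall fun r => ?_)
        ((integrable_mul_weight hℓ h0 t₀).const_mul M).intervalIntegrable
      rw [Real.norm_eq_abs, abs_of_nonneg (mul_nonneg (h0 r) (hu0 r))]
      nlinarith [mul_le_mul_of_nonneg_left (hle r) (h0 r)]
    rw [intervalIntegral.integral_const_mul, abs_mul, abs_of_nonneg hM0] at h1
    have h2 := mul_le_mul_of_nonneg_left (abs_integral_mul_weight_le hℓ h0 t₀ s) hM0
    have h3 := le_mul_of_one_le_right ha (one_le_weight (ℓ := ℓ) t₀ s)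
    have h4 := hu s
    rw [add_mul]
    linarith
  calc u t ≤ M * weight ℓ t₀ t := hle t
    _ ≤ (2 * a) * Real.exp (2 * ∫ r, ℓ r) :=
      mul_le_mul (by linarith) (weight_le hℓ h0 t₀ t) (weight_pos _ _).le (by linarith)
    _ = flowConst ℓ * a := by unfold flowConst; ring

end Weight

/-! ### Global existence and Lipschitz dependence for Carathéodory equations -/

section ODE

variable {F : Type*} [NormedAddCommGroup F]

/-- A time-dependent vector field that is `ℓ t`-Lipschitz at time `t`, with `ℓ` integrable. -/
structure IsCaratheodory (g : ℝ → F → F) (ℓ : ℝ → ℝ) : Prop where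
  integrable : Integrable ℓ
  nonneg : ∀ t, 0 ≤ ℓ t
  norm_sub_le : ∀ t x y, ‖g t x - g t y‖ ≤ ℓ t * ‖x - y‖
  norm_zero_le : ∀ t, ‖g t 0‖ ≤ ℓ t
  aestronglyMeasurable : ∀ γ : ℝ → F, Continuous γ → AEStronglyMeasurable (fun t => g t (γ t))

namespace IsCaratheodory

variable {g : ℝ → F → F} {ℓ : ℝ → ℝ}

theorem norm_le (h : IsCaratheodory g ℓ) (t : ℝ) (x : F) : ‖g t x‖ ≤ ℓ t * (1 + ‖x‖) := by
  have h1 := h.norm_sub_le t x 0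
  have h2 := h.norm_zero_le t
  have h3 := norm_sub_norm_le (g t x) (g t 0)
  rw [sub_zero] at h1
  rw [mul_add, mul_one]
  linarith

theorem integrable_comp (h : IsCaratheodory g ℓ) {γ : ℝ → F} (hγ : Continuous γ) {M : ℝ}
    (hM : ∀ t, ‖γ t‖ ≤ M) : Integrable (fun t => g t (γ t)) := by
  refine (h.integrable.mul_const (1 + M)).mono' (h.aestronglyMeasurable γ hγ)
    (Eventually.of_forall fun t => (h.norm_le t _).trans ?_)
  exact mul_le_mul_of_nonneg_left (by linarith [hM t]) (h.nonneg t)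

variable [NormedSpace ℝ F]

/-- Existence of solutions on the whole time axis. -/
theorem exists_solution [CompleteSpace F] (h : IsCaratheodory g ℓ) (t₀ : ℝ) (x : F) :
    ∃ γ : ℝ → F, Continuous γ ∧ (∃ M, ∀ t, ‖γ t‖ ≤ M) ∧
      ∀ t, γ t = x + ∫ r in t₀..t, g r (γ r) := by
  -- The fixed point is sought for `η = γ / ρ`: after dividing by the weight, the Picard operator is
  -- a `1 / 2`-contraction on the whole time axis, and no local solutions need to be glued.
  set ρ := weight ℓ t₀ with hρ
  have hρc : Continuous ρ := continuous_weight h.integrable t₀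
  have hρ0 : ∀ t, 0 < ρ t := weight_pos t₀
  have hbd : ∀ (η : BoundedContinuousFunction ℝ F) t,
      ‖ρ t • η t‖ ≤ Real.exp (2 * ∫ r, ℓ r) * ‖η‖ := fun η t => by
    rw [norm_smul, Real.norm_eq_abs, abs_of_pos (hρ0 t)]
    exact mul_le_mul (weight_le h.integrable h.nonneg t₀ t) (η.norm_coe_le_norm t)
      (norm_nonneg _) (Real.exp_pos _).le
  have hint : ∀ η : BoundedContinuousFunction ℝ F, Integrable (fun r => g r (ρ r • η r)) :=
    fun η => h.integrable_comp (hρc.smul η.continuous) (hbd η)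
  have hbound : ∀ (η : BoundedContinuousFunction ℝ F) t,
      ‖(ρ t)⁻¹ • (x + ∫ r in t₀..t, g r (ρ r • η r))‖ ≤
        ‖x‖ + ∫ r, ‖g r (ρ r • η r)‖ := fun η t => by
    rw [norm_smul, norm_inv, Real.norm_eq_abs, abs_of_pos (hρ0 t)]
    refine (mul_le_of_le_one_left (norm_nonneg _) (inv_le_one_of_one_le₀
      (one_le_weight t₀ t))).trans ((norm_add_le _ _).trans (by
        gcongr
        exact (intervalIntegral.norm_integral_le_abs_of_norm_le (Eventually.of_forall fun _ => le_rfl)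
          (hint η).norm.intervalIntegrable).trans
          (abs_intervalIntegral_le_integral (hint η).norm (fun _ => norm_nonneg _) _ _)))
  let P : BoundedContinuousFunction ℝ F → BoundedContinuousFunction ℝ F := fun η =>
    BoundedContinuousFunction.ofNormedAddCommGroup
      (fun t => (ρ t)⁻¹ • (x + ∫ r in t₀..t, g r (ρ r • η r)))
      ((hρc.inv₀ fun t => (hρ0 t).ne').smul
        (continuous_const.add (isPrimitive_integral (hint η) t₀).continuous)) _ (hbound η)
  have hP : ∀ η t, P η t = (ρ t)⁻¹ • (x + ∫ r in t₀..t, g r (ρ r • η r)) := fun _ _ => rfl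
  have hcontr : ContractingWith (1 / 2) P := by
    refine ⟨by norm_num [← NNReal.coe_lt_coe], LipschitzWith.of_dist_le_mul fun η₁ η₂ => ?_⟩
    refine (BoundedContinuousFunction.dist_le (by positivity)).2 fun t => ?_
    rw [dist_eq_norm, hP, hP, ← smul_sub, add_sub_add_left_eq_sub,
      ← intervalIntegral.integral_sub (hint η₁).intervalIntegrable (hint η₂).intervalIntegrable,
      norm_smul, norm_inv, Real.norm_eq_abs, abs_of_pos (hρ0 t), inv_mul_le_iff₀ (hρ0 t)]
    have h1 : ‖∫ r in t₀..t, (g r (ρ r • η₁ r) - g r (ρ r • η₂ r))‖ ≤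
        |∫ r in t₀..t, dist η₁ η₂ * (ℓ r * ρ r)| := by
      refine intervalIntegral.norm_integral_le_abs_of_norm_le (Eventually.of_forall fun r => ?_)
        ((integrable_mul_weight h.integrable h.nonneg t₀).const_mul _).intervalIntegrable
      refine (h.norm_sub_le _ _ _).trans ?_
      rw [← smul_sub, norm_smul, Real.norm_eq_abs, abs_of_pos (hρ0 r), ← dist_eq_norm]
      have h2 := mul_le_mul_of_nonneg_left (BoundedContinuousFunction.dist_coe_le_dist
        (f := η₁) (g := η₂) r) (mul_nonneg (h.nonneg r) (hρ0 r).le)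
      linarith
    rw [intervalIntegral.integral_const_mul, abs_mul, abs_of_nonneg dist_nonneg] at h1
    have h3 := mul_le_mul_of_nonneg_left
      (abs_integral_mul_weight_le h.integrable h.nonneg t₀ t) (dist_nonneg (x := η₁) (y := η₂))
    push_cast
    rw [← hρ] at h3
    linarith
  have : Nonempty (BoundedContinuousFunction ℝ F) := ⟨0⟩
  set η := ContractingWith.fixedPoint P hcontr
  have hη : P η = η := hcontr.fixedPoint_isFixedPt
  refine ⟨fun t => ρ t • η t, hρc.smul η.continuous, ⟨_, hbd η⟩, fun t => ?_⟩
  have h1 := hP η t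
  rw [hη] at h1
  simp only
  conv_lhs => rw [h1, smul_inv_smul₀ (hρ0 t).ne']

/-- Grönwall's inequality for the difference of two solutions; equal initial values give uniqueness.
-/
theorem norm_sub_le_of_solutions (h : IsCaratheodory g ℓ) {γ₁ γ₂ : ℝ → F} {x₁ x₂ : F}
    {t₀ M₁ M₂ : ℝ} (hc₁ : Continuous γ₁) (hc₂ : Continuous γ₂)
    (hM₁ : ∀ t, ‖γ₁ t‖ ≤ M₁) (hM₂ : ∀ t, ‖γ₂ t‖ ≤ M₂)
    (h₁ : ∀ t, γ₁ t = x₁ + ∫ r in t₀..t, g r (γ₁ r))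
    (h₂ : ∀ t, γ₂ t = x₂ + ∫ r in t₀..t, g r (γ₂ r)) (t : ℝ) :
    ‖γ₁ t - γ₂ t‖ ≤ flowConst ℓ * ‖x₁ - x₂‖ := by
  have hB : ∀ t, ‖γ₁ t - γ₂ t‖ ≤ M₁ + M₂ := fun t =>
    (_root_.norm_sub_le _ _).trans (add_le_add (hM₁ t) (hM₂ t))
  refine gronwall h.integrable h.nonneg (u := fun t => ‖γ₁ t - γ₂ t‖) (t₀ := t₀)
    (fun _ => norm_nonneg _) hB (norm_nonneg _) (fun t => ?_) t
  have hi : Integrable fun r => ℓ r * ‖γ₁ r - γ₂ r‖ :=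
    h.integrable.mul_bdd (c := M₁ + M₂) (hc₁.sub hc₂).norm.aestronglyMeasurable
      (Eventually.of_forall fun t => by simpa using hB t)
  have h3 : γ₁ t - γ₂ t = (x₁ - x₂) + ∫ r in t₀..t, (g r (γ₁ r) - g r (γ₂ r)) := by
    rw [intervalIntegral.integral_sub (h.integrable_comp hc₁ hM₁).intervalIntegrable
      (h.integrable_comp hc₂ hM₂).intervalIntegrable, h₁ t, h₂ t]
    abel
  rw [h3]
  refine (norm_add_le _ _).trans (add_le_add le_rfl ?_)
  exact intervalIntegral.norm_integral_le_abs_of_norm_le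
    (Eventually.of_forall fun r => h.norm_sub_le _ _ _) hi.intervalIntegrable

end IsCaratheodory

end ODE

section Fields

/-! ### Linear scalar equations and Liouville's formula -/

theorem IsPrimitive.prodMk {F G : Type*} [NormedAddCommGroup F] [NormedAddCommGroup G]
    [NormedSpace ℝ F] [NormedSpace ℝ G] [CompleteSpace F] [CompleteSpace G]
    {γ₁ g₁ : ℝ → F} {γ₂ g₂ : ℝ → G}
    (h₁ : IsPrimitive γ₁ g₁) (h₂ : IsPrimitive γ₂ g₂) :
    IsPrimitive (fun t => (γ₁ t, γ₂ t)) (fun t => (g₁ t, g₂ t)) := by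
  refine ⟨h₁.1.prodMk h₂.1, fun s t => ?_⟩
  have hi : IntervalIntegrable (fun t => (g₁ t, g₂ t)) volume s t :=
    (h₁.1.prodMk h₂.1).intervalIntegrable
  ext
  · have := (ContinuousLinearMap.fst ℝ F G).intervalIntegral_comp_comm hi
    simpa [h₁.2] using this
  · have := (ContinuousLinearMap.snd ℝ F G).intervalIntegral_comp_comm hi
    simpa [h₂.2] using this

theorem isPrimitive_exp {c : ℝ → ℝ} (hc : Integrable c) (a t₀ : ℝ) :
    IsPrimitive (fun t => a * Real.exp (∫ r in t₀..t, c r))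
      (fun t => c t * (a * Real.exp (∫ r in t₀..t, c r))) := by
  have h := (isPrimitive_integral hc t₀).comp_contDiff (f := fun y => a * Real.exp y) (by fun_prop)
  have hd : ∀ y, fderiv ℝ (fun y => a * Real.exp y) y =
      ContinuousLinearMap.toSpanSingleton ℝ (a * Real.exp y) := fun y =>
    ((Real.hasDerivAt_exp y).const_mul a).hasFDerivAt.fderiv
  simpa only [hd, ContinuousLinearMap.toSpanSingleton_apply, smul_eq_mul] using h

/-- By the chain rule for the pair `(γ, ∫ c)`, the product `γ * exp (-∫ c)` has derivative zero. -/
theorem IsPrimitive.eq_mul_exp {γ c : ℝ → ℝ} (hc : Integrable c)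
    (h : IsPrimitive γ (fun t => c t * γ t)) (s t : ℝ) :
    γ t = γ s * Real.exp (∫ r in s..t, c r) := by
  have h1 := (h.prodMk (isPrimitive_integral hc s)).comp_contDiff
    (f := fun p : ℝ × ℝ => p.1 * Real.exp (-p.2)) (by fun_prop)
  have hd : ∀ p : ℝ × ℝ, ∀ r : ℝ,
      fderiv ℝ (fun p : ℝ × ℝ => p.1 * Real.exp (-p.2)) p (r * p.1, r) = 0 := by
    intro p r
    have h2 : HasFDerivAt (fun p : ℝ × ℝ => p.1 * Real.exp (-p.2)) _ p :=
      (hasFDerivAt_fst (p := p)).mul ((hasFDerivAt_snd (p := p)).neg.exp)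
    rw [h2.fderiv]
    simp
    ring
  have h3 := h1.2 s t
  simp only [hd, intervalIntegral.integral_zero, intervalIntegral.integral_same, neg_zero,
    Real.exp_zero, mul_one, sub_eq_zero] at h3
  rw [← h3, mul_assoc, ← Real.exp_add]
  simp

/-! ### The derivative of the determinant -/

section Det

variable {E : Type*} [NormedAddCommGroup E] [NormedSpace ℝ E] [FiniteDimensional ℝ E]

theorem contDiff_det : ContDiff ℝ 1 (fun Z : E →L[ℝ] E => Z.det) := by
  set b := Module.finBasis ℝ E
  have h : (fun Z : E →L[ℝ] E => Z.det) = fun Z : E →L[ℝ] E =>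
      (LinearMap.toMatrix b b (Z : E →ₗ[ℝ] E)).det := by
    ext Z; rw [LinearMap.det_toMatrix]
  rw [h]
  simp only [Matrix.det_apply]
  refine ContDiff.sum fun τ _ => ContDiff.const_smul _ (contDiff_prod fun i _ => ?_)
  let L : (E →L[ℝ] E) →ₗ[ℝ] ℝ :=
    { toFun := fun Z => LinearMap.toMatrix b b (Z : E →ₗ[ℝ] E) (τ i) i
      map_add' := fun Z W => by simp
      map_smul' := fun c Z => by simp }
  exact (LinearMap.toContinuousLinearMap L).contDiff

/-- Jacobi's formula in the direction `A Z` needs no invertibility of `Z`: `det (Z + τ A Z) = det (1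
+ τ A) det Z`, and `det (1 + τ A) = 1 + τ tr A + O(τ²)`. -/
theorem fderiv_det_comp (Z A : E →L[ℝ] E) :
    fderiv ℝ (fun Z : E →L[ℝ] E => Z.det) Z (A ∘L Z) =
      LinearMap.trace ℝ E (A : E →ₗ[ℝ] E) * Z.det := by
  set b := Module.finBasis ℝ E
  have h1 : HasDerivAt (fun τ : ℝ => (Z + τ • (A ∘L Z)).det)
      (fderiv ℝ (fun Z : E →L[ℝ] E => Z.det) Z (A ∘L Z)) 0 := by
    have hl : HasDerivAt (fun τ : ℝ => Z + τ • (A ∘L Z)) (A ∘L Z) 0 := by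
      simpa using ((hasDerivAt_id (0 : ℝ)).smul_const (A ∘L Z)).const_add Z
    have hf : HasFDerivAt (fun Z : E →L[ℝ] E => Z.det)
        (fderiv ℝ (fun Z : E →L[ℝ] E => Z.det) Z) (Z + (0 : ℝ) • (A ∘L Z)) := by
      rw [zero_smul, add_zero]
      exact (contDiff_det.differentiable one_ne_zero Z).hasFDerivAt
    exact hf.comp_hasDerivAt (0 : ℝ) hl
  set M := LinearMap.toMatrix b b (A : E →ₗ[ℝ] E)
  -- The polynomial `det (1 + X M)` without its constant and linear terms, divided by `X²`.
  set p := (Matrix.det (1 + (Polynomial.X : Polynomial ℝ) • M.map Polynomial.C)).divX.divX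
  have h2 : ∀ τ : ℝ, (Z + τ • (A ∘L Z)).det =
      (1 + M.trace * τ + p.eval τ * τ ^ 2) * Z.det := by
    intro τ
    have h3 : Z + τ • (A ∘L Z) = (1 + τ • A) ∘L Z := by ext x; simp
    rw [h3, ← Matrix.det_one_add_smul]
    change LinearMap.det (((1 + τ • A : E →L[ℝ] E) : E →ₗ[ℝ] E) ∘ₗ (Z : E →ₗ[ℝ] E)) = _
    rw [LinearMap.det_comp, ← LinearMap.det_toMatrix b]
    congr 2
    change LinearMap.toMatrix b b (1 + τ • (A : E →ₗ[ℝ] E)) = _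
    rw [map_add, map_smul, LinearMap.toMatrix_one]
  have h4 : HasDerivAt (fun τ : ℝ => (1 + M.trace * τ + p.eval τ * τ ^ 2) * Z.det)
      (M.trace * Z.det) 0 := by
    have h5 := ((((hasDerivAt_id (0 : ℝ)).const_mul M.trace).const_add 1).add
      ((p.hasDerivAt 0).mul (hasDerivAt_pow 2 (0 : ℝ)))).mul_const Z.det
    simpa using h5
  simp only [h2] at h1
  rw [h1.unique h4, LinearMap.trace_eq_matrix_trace ℝ b]

end Det

/-! ### Time-dependent `C¹` vector fields and their flows -/

namespace IsCaratheodory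

variable {F : Type*} [NormedAddCommGroup F] [NormedSpace ℝ F] [CompleteSpace F]
  {g : ℝ → F → F} {ℓ : ℝ → ℝ}

/-- The value at time `t` of the solution with value `x` at time `t₀`. -/
def flow (h : IsCaratheodory g ℓ) (t₀ t : ℝ) (x : F) : F :=
  (h.exists_solution t₀ x).choose t

variable (h : IsCaratheodory g ℓ)

theorem continuous_flow (t₀ : ℝ) (x : F) : Continuous (fun t => h.flow t₀ t x) :=
  (h.exists_solution t₀ x).choose_spec.1

theorem exists_norm_flow_le (t₀ : ℝ) (x : F) : ∃ M, ∀ t, ‖h.flow t₀ t x‖ ≤ M :=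
  (h.exists_solution t₀ x).choose_spec.2.1

theorem flow_eq (t₀ t : ℝ) (x : F) :
    h.flow t₀ t x = x + ∫ r in t₀..t, g r (h.flow t₀ r x) :=
  (h.exists_solution t₀ x).choose_spec.2.2 t

theorem integrable_flow (t₀ : ℝ) (x : F) : Integrable (fun r => g r (h.flow t₀ r x)) :=
  h.integrable_comp (h.continuous_flow t₀ x) (h.exists_norm_flow_le t₀ x).choose_spec

theorem isPrimitive_flow (t₀ : ℝ) (x : F) :
    IsPrimitive (fun t => h.flow t₀ t x) (fun r => g r (h.flow t₀ r x)) :=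
  isPrimitive_of_eq (h.integrable_flow t₀ x) fun t => h.flow_eq t₀ t x

@[simp]
theorem flow_self (t₀ : ℝ) (x : F) : h.flow t₀ t₀ x = x := by
  rw [h.flow_eq]; simp

theorem norm_flow_sub_flow_le (t₀ t : ℝ) (x y : F) :
    ‖h.flow t₀ t x - h.flow t₀ t y‖ ≤ flowConst ℓ * ‖x - y‖ :=
  h.norm_sub_le_of_solutions (h.continuous_flow t₀ x) (h.continuous_flow t₀ y)
    (h.exists_norm_flow_le t₀ x).choose_spec (h.exists_norm_flow_le t₀ y).choose_spec
    (fun t => h.flow_eq t₀ t x) (fun t => h.flow_eq t₀ t y) t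

theorem eq_flow {γ : ℝ → F} (hγ : IsPrimitive γ (fun r => g r (γ r))) (t₀ t : ℝ) :
    γ t = h.flow t₀ t (γ t₀) := by
  have := h.norm_sub_le_of_solutions hγ.continuous (h.continuous_flow t₀ (γ t₀)) hγ.norm_le
    (h.exists_norm_flow_le t₀ (γ t₀)).choose_spec (fun t => hγ.eq_add t₀ t)
    (fun t => h.flow_eq t₀ t (γ t₀)) t
  rw [sub_self, norm_zero, mul_zero, norm_le_zero_iff, sub_eq_zero] at this
  exact this

theorem flow_flow (r s t : ℝ) (x : F) : h.flow s t (h.flow r s x) = h.flow r t x :=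
  (h.eq_flow (h.isPrimitive_flow r x) s t).symm

end IsCaratheodory

variable {V E : Type*} [NormedAddCommGroup V] [NormedSpace ℝ V]
  [NormedAddCommGroup E] [NormedSpace ℝ E]

/-- A normed space `V` of bounded `C¹` vector fields on `E` with bounded, uniformly continuous
derivative, whose norm controls the `C¹` norm. -/
structure IsC1Family (e : V →ₗ[ℝ] (E → E)) (C : ℝ) : Prop where
  nonneg : 0 ≤ C
  contDiff : ∀ u, ContDiff ℝ 1 (e u)
  norm_le : ∀ u x, ‖e u x‖ ≤ C * ‖u‖
  norm_fderiv_le : ∀ u x, ‖fderiv ℝ (e u) x‖ ≤ C * ‖u‖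
  uniformContinuous : ∀ u, UniformContinuous (fderiv ℝ (e u))

namespace IsC1Family

variable {e : V →ₗ[ℝ] (E → E)} {C : ℝ} (h : IsC1Family e C)

include h

theorem hasFDerivAt (u : V) (x : E) : HasFDerivAt (e u) (fderiv ℝ (e u) x) x :=
  ((h.contDiff u).differentiable one_ne_zero x).hasFDerivAt

theorem fderiv_map_sub (u u' : V) (x : E) :
    fderiv ℝ (e (u - u')) x = fderiv ℝ (e u) x - fderiv ℝ (e u') x := by
  rw [map_sub]
  exact ((h.hasFDerivAt u x).sub (h.hasFDerivAt u' x)).fderiv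

theorem norm_map_sub_le (u : V) (x y : E) : ‖e u x - e u y‖ ≤ C * ‖u‖ * ‖x - y‖ :=
  convex_univ.norm_image_sub_le_of_norm_hasFDerivWithin_le
    (fun x _ => (h.hasFDerivAt u x).hasFDerivWithinAt) (fun x _ => h.norm_fderiv_le u x)
    (mem_univ _) (mem_univ _)

/-- Joint continuity is what makes `t ↦ e (v t) (γ t)` measurable when `v` is merely measurable. -/
theorem continuous_eval : Continuous (fun p : V × E => e p.1 p.2) := by
  refine continuous_iff_continuousAt.2 fun p => ?_
  have h1 : Tendsto (fun q : V × E => C * ‖q.1 - p.1‖ + ‖e p.1 q.2 - e p.1 p.2‖) (𝓝 p) (𝓝 0) := by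
    have hc : Continuous (fun q : V × E => C * ‖q.1 - p.1‖ + ‖e p.1 q.2 - e p.1 p.2‖) := by
      have := (h.contDiff p.1).continuous
      fun_prop
    simpa using hc.tendsto p
  refine tendsto_iff_norm_sub_tendsto_zero.2 (squeeze_zero (fun _ => norm_nonneg _) (fun q => ?_) h1)
  have h2 : e q.1 q.2 - e p.1 p.2 = e (q.1 - p.1) q.2 + (e p.1 q.2 - e p.1 p.2) := by
    rw [map_sub, Pi.sub_apply]; abel
  rw [h2]
  exact (norm_add_le _ _).trans (add_le_add (h.norm_le _ _) le_rfl)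

theorem continuous_fderiv_eval : Continuous (fun p : V × E => fderiv ℝ (e p.1) p.2) := by
  refine continuous_iff_continuousAt.2 fun p => ?_
  have h1 : Tendsto (fun q : V × E => C * ‖q.1 - p.1‖ +
      ‖fderiv ℝ (e p.1) q.2 - fderiv ℝ (e p.1) p.2‖) (𝓝 p) (𝓝 0) := by
    have hc : Continuous (fun q : V × E => C * ‖q.1 - p.1‖ +
        ‖fderiv ℝ (e p.1) q.2 - fderiv ℝ (e p.1) p.2‖) := by
      have := (h.contDiff p.1).continuous_fderiv one_ne_zero
      fun_prop
    simpa using hc.tendsto p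
  refine tendsto_iff_norm_sub_tendsto_zero.2 (squeeze_zero (fun _ => norm_nonneg _) (fun q => ?_) h1)
  have h2 : fderiv ℝ (e q.1) q.2 - fderiv ℝ (e p.1) p.2 = fderiv ℝ (e (q.1 - p.1)) q.2 +
      (fderiv ℝ (e p.1) q.2 - fderiv ℝ (e p.1) p.2) := by
    rw [h.fderiv_map_sub]; abel
  rw [h2]
  exact (norm_add_le _ _).trans (add_le_add (h.norm_fderiv_le _ _) le_rfl)

variable {v : ℝ → V} (hv : Integrable v)

include hv

theorem isCaratheodory : IsCaratheodory (fun t => e (v t)) (fun t => C * ‖v t‖) where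
  integrable := hv.norm.const_mul C
  nonneg _ := mul_nonneg h.nonneg (norm_nonneg _)
  norm_sub_le _ _ _ := h.norm_map_sub_le _ _ _
  norm_zero_le _ := h.norm_le _ _
  aestronglyMeasurable _ hγ := h.continuous_eval.comp_aestronglyMeasurable
    (hv.aestronglyMeasurable.prodMk hγ.aestronglyMeasurable)

theorem aestronglyMeasurable_fderiv {γ : ℝ → E} (hγ : Continuous γ) :
    AEStronglyMeasurable (fun t => fderiv ℝ (e (v t)) (γ t)) :=
  h.continuous_fderiv_eval.comp_aestronglyMeasurable
    (hv.aestronglyMeasurable.prodMk hγ.aestronglyMeasurable)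

theorem integrable_fderiv {γ : ℝ → E} (hγ : Continuous γ) :
    Integrable (fun t => fderiv ℝ (e (v t)) (γ t)) :=
  (hv.norm.const_mul C).mono' (h.aestronglyMeasurable_fderiv hv hγ)
    (Eventually.of_forall fun _ => h.norm_fderiv_le _ _)

/-- The derivatives of the fields `v t` have, up to an integrable error of small mass, a common
modulus of continuity. -/
theorem exists_fderiv_modulus {ε : ℝ} (hε : 0 < ε) :
    ∃ δ > 0, ∃ k : ℝ → ℝ, Integrable k ∧ (∀ r, 0 ≤ k r) ∧ ∫ r, k r ≤ ε ∧
      ∀ r x y, ‖x - y‖ ≤ δ → ‖fderiv ℝ (e (v r)) x - fderiv ℝ (e (v r)) y‖ ≤ k r := by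
  have hC := h.nonneg
  set ε' := ε / (2 * (2 * C + 1)) with hε'
  have hε'0 : 0 < ε' := by positivity
  -- A simple function close to `v` in `L¹` takes finitely many values, so the derivatives of its
  -- fields share one modulus of continuity; the error costs at most `2 * C * ‖v r - s r‖`. The
  -- constant modulus `η` is charged only on the support of `s`, which has finite measure.
  obtain ⟨s, hs, hsL⟩ := (memLp_one_iff_integrable.2 hv).exists_simpleFunc_eLpNorm_sub_lt
    ENNReal.one_ne_top (ENNReal.ofReal_pos.2 hε'0).ne'
  have hsi : Integrable s := memLp_one_iff_integrable.1 hsL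
  have hvs : Integrable (fun r => v r - s r) := hv.sub hsi
  have hs1 : ∫ r, ‖v r - s r‖ ≤ ε' := by
    rw [integral_norm_eq_lintegral_enorm hvs.aestronglyMeasurable]
    rw [eLpNorm_one_eq_lintegral_enorm] at hs
    exact ENNReal.toReal_le_of_le_ofReal hε'0.le hs.le
  have hsupp := s.measure_support_lt_top_of_integrable hsi
  set m := volume.real (Function.support s) with hm
  set η := ε / (2 * (m + 1)) with hη
  have hm0 : 0 ≤ m := measureReal_nonneg
  have hη0 : 0 < η := by positivity
  have hev : ∀ u ∈ s.range, ∀ᶠ δ in 𝓝[>] (0 : ℝ), ∀ x y, ‖x - y‖ ≤ δ →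
      ‖fderiv ℝ (e u) x - fderiv ℝ (e u) y‖ ≤ η := by
    intro u _
    obtain ⟨δ, hδ, hδ'⟩ := Metric.uniformContinuous_iff.1 (h.uniformContinuous u) η hη0
    filter_upwards [Ioo_mem_nhdsGT hδ] with d hd x y hxy
    have h1 := hδ' (a := x) (b := y) (by rw [dist_eq_norm]; exact hxy.trans_lt hd.2)
    rw [dist_eq_norm] at h1
    exact h1.le
  obtain ⟨δ, hδ, hδ0⟩ := (((Filter.eventually_all_finset s.range).2 hev).and
    self_mem_nhdsWithin).exists
  have hind : Integrable ((Function.support s).indicator fun _ => η) :=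
    (integrable_indicator_iff s.measurableSet_support).2 (integrableOn_const hsupp.ne)
  refine ⟨δ, hδ0, fun r => (Function.support s).indicator (fun _ => η) r + 2 * C * ‖v r - s r‖,
    hind.add (hvs.norm.const_mul _), fun r => ?_, ?_, fun r x y hxy => ?_⟩
  · exact add_nonneg (indicator_nonneg (fun _ _ => hη0.le) _) (by positivity)
  · rw [integral_add hind (hvs.norm.const_mul _), integral_const_mul,
      integral_indicator_const _ s.measurableSet_support, smul_eq_mul, ← hm]
    have h1 : m * η ≤ ε / 2 := by
      rw [hη, show m * (ε / (2 * (m + 1))) = ε / 2 * (m / (m + 1)) by field_simp]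
      exact mul_le_of_le_one_right (by positivity) ((div_le_one (by linarith)).2 (by linarith))
    have h2 : 2 * C * ∫ r, ‖v r - s r‖ ≤ ε / 2 := by
      refine (mul_le_mul_of_nonneg_left hs1 (by positivity)).trans ?_
      rw [hε', show 2 * C * (ε / (2 * (2 * C + 1))) = ε / 2 * (2 * C / (2 * C + 1)) by field_simp]
      exact mul_le_of_le_one_right (by positivity) ((div_le_one (by linarith)).2 (by linarith))
    exact (add_le_add h1 h2).trans (by linarith)
  · have h1 : ‖fderiv ℝ (e (s r)) x - fderiv ℝ (e (s r)) y‖ ≤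
        (Function.support s).indicator (fun _ => η) r := by
      by_cases hr : r ∈ Function.support s
      · rw [indicator_of_mem hr]
        exact hδ (s r) (s.mem_range_self r) x y hxy
      · rw [indicator_of_notMem hr, Function.notMem_support.1 hr]
        have h2 := h.norm_fderiv_le 0 x
        have h3 := h.norm_fderiv_le 0 y
        rw [norm_zero, mul_zero, norm_le_zero_iff] at h2 h3
        rw [h2, h3, sub_zero, norm_zero]
    have h2 : fderiv ℝ (e (v r)) x - fderiv ℝ (e (v r)) y =
        (fderiv ℝ (e (s r)) x - fderiv ℝ (e (s r)) y) +
        (fderiv ℝ (e (v r - s r)) x - fderiv ℝ (e (v r - s r)) y) := by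
      rw [h.fderiv_map_sub, h.fderiv_map_sub]; abel
    rw [h2]
    refine (norm_add_le _ _).trans (add_le_add h1 ((norm_sub_le _ _).trans ?_))
    have h3 := h.norm_fderiv_le (v r - s r) x
    have h4 := h.norm_fderiv_le (v r - s r) y
    linarith

end IsC1Family

end Fields

/-! ### Differentiability of the flow in space -/

section FlowDerivative

namespace IsC1Family

variable {V E : Type*} [NormedAddCommGroup V] [NormedSpace ℝ V]
  [NormedAddCommGroup E] [NormedSpace ℝ E] [CompleteSpace E]
  {e : V →ₗ[ℝ] (E → E)} {C : ℝ} (h : IsC1Family e C) {v : ℝ → V} (hv : Integrable v)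

/-- The flow of the time-dependent field `e (v t)`, from time `t₀` to time `t`. -/
def flow (t₀ t : ℝ) (x : E) : E := (h.isCaratheodory hv).flow t₀ t x

-- The variational equation along `γ` is again a Carathéodory equation, now for operators, so
-- existence and Grönwall estimates apply to the derivative of the flow.
include h hv in
omit [CompleteSpace E] in
theorem isCaratheodory_linear {γ : ℝ → E} (hγ : Continuous γ) :
    IsCaratheodory (fun t (Z : E →L[ℝ] E) => fderiv ℝ (e (v t)) (γ t) ∘L Z)
      (fun t => C * ‖v t‖) where
  integrable := hv.norm.const_mul C
  nonneg _ := mul_nonneg h.nonneg (norm_nonneg _)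
  norm_sub_le t Z W := by
    rw [← ContinuousLinearMap.comp_sub]
    exact (ContinuousLinearMap.opNorm_comp_le _ _).trans
      (mul_le_mul_of_nonneg_right (h.norm_fderiv_le _ _) (norm_nonneg _))
  norm_zero_le t := by
    rw [ContinuousLinearMap.comp_zero, norm_zero]
    exact mul_nonneg h.nonneg (norm_nonneg _)
  aestronglyMeasurable _ hZ := (ContinuousLinearMap.compL ℝ E E E).aestronglyMeasurable_comp₂
    (h.aestronglyMeasurable_fderiv hv hγ) hZ.aestronglyMeasurable

theorem continuous_flow_time (t₀ : ℝ) (x : E) : Continuous (fun t => h.flow hv t₀ t x) :=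
  (h.isCaratheodory hv).continuous_flow t₀ x

theorem isPrimitive_flow (t₀ : ℝ) (x : E) :
    IsPrimitive (fun t => h.flow hv t₀ t x) (fun r => e (v r) (h.flow hv t₀ r x)) :=
  (h.isCaratheodory hv).isPrimitive_flow t₀ x

@[simp]
theorem flow_self (t : ℝ) (x : E) : h.flow hv t t x = x := (h.isCaratheodory hv).flow_self t x

theorem flow_flow (r s t : ℝ) (x : E) : h.flow hv s t (h.flow hv r s x) = h.flow hv r t x :=
  (h.isCaratheodory hv).flow_flow r s t x

/-- The derivative in space of the flow, defined through the variational equation. -/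
def flowDeriv (t₀ t : ℝ) (x : E) : E →L[ℝ] E :=
  (h.isCaratheodory_linear hv (h.continuous_flow_time hv t₀ x)).flow t₀ t
    (ContinuousLinearMap.id ℝ E)

theorem isPrimitive_flowDeriv (t₀ : ℝ) (x : E) :
    IsPrimitive (fun t => h.flowDeriv hv t₀ t x)
      (fun r => fderiv ℝ (e (v r)) (h.flow hv t₀ r x) ∘L h.flowDeriv hv t₀ r x) :=
  (h.isCaratheodory_linear hv (h.continuous_flow_time hv t₀ x)).isPrimitive_flow t₀ _

@[simp]
theorem flowDeriv_self (t : ℝ) (x : E) : h.flowDeriv hv t t x = ContinuousLinearMap.id ℝ E :=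
  (h.isCaratheodory_linear hv (h.continuous_flow_time hv t x)).flow_self t _

/-- A uniform Lipschitz constant of the flow. -/
def lip (C : ℝ) (v : ℝ → V) : ℝ := flowConst fun t => C * ‖v t‖

omit [NormedSpace ℝ V] in
theorem lip_pos (C : ℝ) (v : ℝ → V) : 0 < lip C v := flowConst_pos _

theorem norm_flow_sub_flow_le (t₀ t : ℝ) (x y : E) :
    ‖h.flow hv t₀ t x - h.flow hv t₀ t y‖ ≤ lip C v * ‖x - y‖ :=
  (h.isCaratheodory hv).norm_flow_sub_flow_le t₀ t x y

/-- Zero solves the linear variational equation, so Lipschitz dependence on the initial value bounds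
the solution starting at the identity. -/
theorem norm_flowDeriv_le (t₀ t : ℝ) (x : E) : ‖h.flowDeriv hv t₀ t x‖ ≤ lip C v := by
  set hL := h.isCaratheodory_linear hv (h.continuous_flow_time hv t₀ x)
  have h1 := hL.norm_flow_sub_flow_le t₀ t (ContinuousLinearMap.id ℝ E) 0
  have h2 : IsPrimitive (fun _ : ℝ => (0 : E →L[ℝ] E))
      (fun r => fderiv ℝ (e (v r)) (h.flow hv t₀ r x) ∘L (0 : E →L[ℝ] E)) := by
    simp only [ContinuousLinearMap.comp_zero]
    exact ⟨integrable_zero _ _ _, fun s t => by simp⟩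
  rw [← hL.eq_flow h2 t₀ t, sub_zero, sub_zero] at h1
  exact h1.trans (mul_le_of_le_one_right (lip_pos C v).le ContinuousLinearMap.norm_id_le)

/-- The remainder `z` solves the variational equation up to a source, the first-order remainder of
the field between two nearby trajectories. The modulus `k` makes the source small compared with `‖y
- x‖`, and Grönwall's inequality passes this on to `z`. -/
theorem hasFDerivAt_flow (t₀ t : ℝ) (x : E) :
    HasFDerivAt (h.flow hv t₀ t) (h.flowDeriv hv t₀ t x) x := by
  refine .of_isLittleO (Asymptotics.isLittleO_iff.2 fun ε hε => ?_)
  set K := lip C v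
  have hK : 0 < K := lip_pos C v
  -- One factor `K` is the Lipschitz constant of the flow, the other the constant of Grönwall's
  -- inequality.
  obtain ⟨δ, hδ, k, hk, hk0, hkε, hmod⟩ := h.exists_fderiv_modulus hv (ε := ε / (K * K))
    (by positivity)
  filter_upwards [Metric.ball_mem_nhds x (show 0 < δ / K by positivity)] with y hy
  rw [Metric.mem_ball, dist_eq_norm, lt_div_iff₀ hK] at hy
  have hclose : ∀ r, ‖h.flow hv t₀ r y - h.flow hv t₀ r x‖ ≤ K * ‖y - x‖ := fun r =>
    h.norm_flow_sub_flow_le hv t₀ r y x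
  set z : ℝ → E := fun r => h.flow hv t₀ r y - h.flow hv t₀ r x - h.flowDeriv hv t₀ r x (y - x)
    with hz
  have hpy := h.isPrimitive_flow hv t₀ y
  have hpx := h.isPrimitive_flow hv t₀ x
  have hpZ := h.isPrimitive_flowDeriv hv t₀ x
  have hZi : Integrable (fun r => fderiv ℝ (e (v r)) (h.flow hv t₀ r x)
      (h.flowDeriv hv t₀ r x (y - x))) :=
    (ContinuousLinearMap.apply ℝ E (y - x)).integrable_comp hpZ.1
  have hZ : ∀ s, h.flowDeriv hv t₀ s x (y - x) = (y - x) + ∫ r in t₀..s,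
      fderiv ℝ (e (v r)) (h.flow hv t₀ r x) (h.flowDeriv hv t₀ r x (y - x)) := by
    intro s
    have h1 := (ContinuousLinearMap.apply ℝ E (y - x)).intervalIntegral_comp_comm
      (hpZ.1.intervalIntegrable (a := t₀) (b := s))
    rw [← hpZ.2 t₀ s] at h1
    simp only [ContinuousLinearMap.apply_apply, ContinuousLinearMap.comp_apply, sub_apply,
      flowDeriv_self, ContinuousLinearMap.id_apply] at h1
    rw [h1]; abel
  have hzeq : ∀ s, z s = ∫ r in t₀..s, (e (v r) (h.flow hv t₀ r y) - e (v r) (h.flow hv t₀ r x) -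
      fderiv ℝ (e (v r)) (h.flow hv t₀ r x) (h.flowDeriv hv t₀ r x (y - x))) := by
    intro s
    have hyx : Integrable (fun r => e (v r) (h.flow hv t₀ r y) - e (v r) (h.flow hv t₀ r x)) :=
      hpy.1.sub hpx.1
    rw [intervalIntegral.integral_sub hyx.intervalIntegrable hZi.intervalIntegrable,
      intervalIntegral.integral_sub hpy.1.intervalIntegrable hpx.1.intervalIntegrable,
      ← hpy.2 t₀ s, ← hpx.2 t₀ s, hz]
    simp only [hZ s, flow_self]
    abel
  have hzB : ∀ s, ‖z s‖ ≤ K * ‖y - x‖ + K * ‖y - x‖ := fun s =>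
    (norm_sub_le _ _).trans (add_le_add (hclose s) ((ContinuousLinearMap.le_opNorm _ _).trans
      (mul_le_mul_of_nonneg_right (h.norm_flowDeriv_le hv t₀ s x) (norm_nonneg _))))
  have hzc : Continuous z := (hpy.continuous.sub hpx.continuous).sub
    (hpZ.continuous.clm_apply continuous_const)
  have hℓz : Integrable fun r => C * ‖v r‖ * ‖z r‖ :=
    (hv.norm.const_mul C).mul_bdd (c := K * ‖y - x‖ + K * ‖y - x‖)
      hzc.norm.aestronglyMeasurable (Eventually.of_forall fun s => by simpa using hzB s)
  have hg := gronwall (hv.norm.const_mul C) (fun r => mul_nonneg h.nonneg (norm_nonneg (v r)))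
    (u := fun s => ‖z s‖) (t₀ := t₀) (a := ε / (K * K) * (K * ‖y - x‖))
    (fun s => norm_nonneg _) hzB (by positivity) (fun s => ?_) t
  · refine hg.trans (le_of_eq ?_)
    change K * _ = _
    field_simp
  have hkm : Integrable fun r => k r * (K * ‖y - x‖) := hk.mul_const _
  have h3 : ‖z s‖ ≤ |∫ r in t₀..s, (k r * (K * ‖y - x‖) + C * ‖v r‖ * ‖z r‖)| := by
    rw [hzeq s]
    refine intervalIntegral.norm_integral_le_abs_of_norm_le (Eventually.of_forall fun r => ?_)
      (hkm.add hℓz).intervalIntegrable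
    have h4 : e (v r) (h.flow hv t₀ r y) - e (v r) (h.flow hv t₀ r x) -
        fderiv ℝ (e (v r)) (h.flow hv t₀ r x) (h.flowDeriv hv t₀ r x (y - x)) =
        (e (v r) (h.flow hv t₀ r y) - e (v r) (h.flow hv t₀ r x) -
          fderiv ℝ (e (v r)) (h.flow hv t₀ r x) (h.flow hv t₀ r y - h.flow hv t₀ r x)) +
        fderiv ℝ (e (v r)) (h.flow hv t₀ r x) (z r) := by
      simp only [hz, map_sub]; abel
    rw [h4]
    refine (norm_add_le _ _).trans (add_le_add ?_ ((ContinuousLinearMap.le_opNorm _ _).trans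
      (mul_le_mul_of_nonneg_right (h.norm_fderiv_le _ _) (norm_nonneg _))))
    refine ((convex_closedBall (h.flow hv t₀ r x) δ).norm_image_sub_le_of_norm_hasFDerivWithin_le'
      (fun x _ => (h.hasFDerivAt (v r) x).hasFDerivWithinAt) (fun w hw => hmod r w _ ?_)
      (Metric.mem_closedBall_self hδ.le) ?_).trans
      (mul_le_mul_of_nonneg_left (hclose r) (hk0 r))
    · rw [← dist_eq_norm]; exact hw
    · rw [Metric.mem_closedBall, dist_eq_norm]
      exact (hclose r).trans (by linarith)
  refine h3.trans ?_
  rw [intervalIntegral.integral_add hkm.intervalIntegrable hℓz.intervalIntegrable,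
    intervalIntegral.integral_mul_const]
  refine (abs_add_le _ _).trans (add_le_add ?_ le_rfl)
  rw [abs_mul, abs_of_nonneg (show 0 ≤ K * ‖y - x‖ by positivity)]
  exact mul_le_mul_of_nonneg_right ((abs_intervalIntegral_le_integral hk hk0 _ _).trans hkε)
    (by positivity)

theorem flowDeriv_comp (r s t : ℝ) (x : E) :
    h.flowDeriv hv s t (h.flow hv r s x) ∘L h.flowDeriv hv r s x = h.flowDeriv hv r t x := by
  have h1 := (h.hasFDerivAt_flow hv s t (h.flow hv r s x)).comp x (h.hasFDerivAt_flow hv r s x)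
  have h2 : h.flow hv s t ∘ h.flow hv r s = h.flow hv r t := funext fun x => h.flow_flow hv r s t x
  rw [h2] at h1
  exact h1.unique (h.hasFDerivAt_flow hv r t x)

/-- The derivative of the flow is continuous in space, uniformly in time. -/
theorem exists_norm_flowDeriv_sub_le (t₀ : ℝ) {ε : ℝ} (hε : 0 < ε) :
    ∃ δ > 0, ∀ x y, ‖y - x‖ ≤ δ →
      ∀ t, ‖h.flowDeriv hv t₀ t y - h.flowDeriv hv t₀ t x‖ ≤ ε := by
  set K := lip C v
  have hK : 0 < K := lip_pos C v
  obtain ⟨δ, hδ, k, hk, hk0, hkε, hmod⟩ := h.exists_fderiv_modulus hv (ε := ε / (K * K))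
    (by positivity)
  refine ⟨δ / K, by positivity, fun x y hxy t => ?_⟩
  rw [le_div_iff₀ hK] at hxy
  set z : ℝ → E →L[ℝ] E := fun r => h.flowDeriv hv t₀ r y - h.flowDeriv hv t₀ r x with hz
  have hpy := h.isPrimitive_flowDeriv hv t₀ y
  have hpx := h.isPrimitive_flowDeriv hv t₀ x
  have hzB : ∀ s, ‖z s‖ ≤ K + K := fun s => (norm_sub_le _ _).trans
    (add_le_add (h.norm_flowDeriv_le hv t₀ s y) (h.norm_flowDeriv_le hv t₀ s x))
  have hzc : Continuous z := hpy.continuous.sub hpx.continuous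
  have hℓz : Integrable fun r => C * ‖v r‖ * ‖z r‖ :=
    (hv.norm.const_mul C).mul_bdd (c := K + K)
      hzc.norm.aestronglyMeasurable (Eventually.of_forall fun s => by simpa using hzB s)
  have hkm : Integrable fun r => k r * K := hk.mul_const _
  have hg := gronwall (hv.norm.const_mul C) (fun r => mul_nonneg h.nonneg (norm_nonneg (v r)))
    (u := fun s => ‖z s‖) (t₀ := t₀) (a := ε / (K * K) * K)
    (fun s => norm_nonneg _) hzB (by positivity) (fun s => ?_) t
  · refine hg.trans (le_of_eq ?_)
    change K * _ = _
    field_simp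
  have h3 : ‖z s‖ ≤ |∫ r in t₀..s, (k r * K + C * ‖v r‖ * ‖z r‖)| := by
    have h4 : z s = ∫ r in t₀..s, (fderiv ℝ (e (v r)) (h.flow hv t₀ r y) ∘L h.flowDeriv hv t₀ r y -
        fderiv ℝ (e (v r)) (h.flow hv t₀ r x) ∘L h.flowDeriv hv t₀ r x) := by
      rw [intervalIntegral.integral_sub hpy.1.intervalIntegrable hpx.1.intervalIntegrable,
        ← hpy.2, ← hpx.2, hz]
      simp
    rw [h4]
    refine intervalIntegral.norm_integral_le_abs_of_norm_le (Eventually.of_forall fun r => ?_)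
      (hkm.add hℓz).intervalIntegrable
    have h5 : fderiv ℝ (e (v r)) (h.flow hv t₀ r y) ∘L h.flowDeriv hv t₀ r y -
        fderiv ℝ (e (v r)) (h.flow hv t₀ r x) ∘L h.flowDeriv hv t₀ r x =
        (fderiv ℝ (e (v r)) (h.flow hv t₀ r y) - fderiv ℝ (e (v r)) (h.flow hv t₀ r x)) ∘L
          h.flowDeriv hv t₀ r y + fderiv ℝ (e (v r)) (h.flow hv t₀ r x) ∘L z r := by
      rw [hz, ContinuousLinearMap.comp_sub, ContinuousLinearMap.sub_comp]; abel
    rw [h5]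
    refine (norm_add_le _ _).trans (add_le_add
      ((ContinuousLinearMap.opNorm_comp_le _ _).trans (mul_le_mul (hmod r _ _ ?_)
        (h.norm_flowDeriv_le hv t₀ r y) (norm_nonneg _) (hk0 r)))
      ((ContinuousLinearMap.opNorm_comp_le _ _).trans
        (mul_le_mul_of_nonneg_right (h.norm_fderiv_le _ _) (norm_nonneg _))))
    exact (h.norm_flow_sub_flow_le hv t₀ r y x).trans (by linarith)
  refine h3.trans ?_
  rw [intervalIntegral.integral_add hkm.intervalIntegrable hℓz.intervalIntegrable,
    intervalIntegral.integral_mul_const]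
  refine (abs_add_le _ _).trans (add_le_add ?_ le_rfl)
  rw [abs_mul, abs_of_pos hK]
  exact mul_le_mul_of_nonneg_right ((abs_intervalIntegral_le_integral hk hk0 _ _).trans hkε) hK.le

theorem continuous_flowDeriv (t₀ : ℝ) :
    Continuous (fun p : ℝ × E => h.flowDeriv hv t₀ p.1 p.2) := by
  refine continuous_iff_continuousAt.2 fun p => Metric.continuousAt_iff'.2 fun ε hε => ?_
  obtain ⟨δ, hδ, hδ'⟩ := h.exists_norm_flowDeriv_sub_le hv t₀ (half_pos hε)
  have h1 : ∀ᶠ q : ℝ × E in 𝓝 p,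
      dist (h.flowDeriv hv t₀ q.1 p.2) (h.flowDeriv hv t₀ p.1 p.2) < ε / 2 :=
    ((h.isPrimitive_flowDeriv hv t₀ p.2).continuous.comp continuous_fst).continuousAt.eventually
      (Metric.ball_mem_nhds _ (half_pos hε))
  have h2 : ∀ᶠ q : ℝ × E in 𝓝 p, dist q.2 p.2 < δ :=
    continuous_snd.continuousAt.eventually (Metric.ball_mem_nhds _ hδ)
  filter_upwards [h1, h2] with q hq1 hq2
  have h3 := hδ' p.2 q.2 (by rw [← dist_eq_norm]; exact hq2.le) q.1
  rw [← dist_eq_norm] at h3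
  linarith [dist_triangle (h.flowDeriv hv t₀ q.1 q.2) (h.flowDeriv hv t₀ q.1 p.2)
    (h.flowDeriv hv t₀ p.1 p.2)]

/-- The backward flow is jointly continuous in time and space. -/
theorem continuous_flow_symm (t₀ : ℝ) : Continuous (fun p : ℝ × E => h.flow hv p.1 t₀ p.2) := by
  refine continuous_iff_continuousAt.2 fun p => tendsto_iff_norm_sub_tendsto_zero.2 ?_
  -- `q.2` is compared with the position at time `q.1` of the trajectory through `p`, which flows
  -- back exactly to `y`; the Lipschitz bound is uniform in the times.
  set y := h.flow hv p.1 t₀ p.2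
  have h1 : Continuous (fun q : ℝ × E => lip C v * ‖q.2 - h.flow hv t₀ q.1 y‖) :=
    continuous_const.mul
      (continuous_snd.sub ((h.continuous_flow_time hv t₀ y).comp continuous_fst)).norm
  have h2 : Tendsto (fun q : ℝ × E => lip C v * ‖q.2 - h.flow hv t₀ q.1 y‖) (𝓝 p) (𝓝 0) := by
    simpa [y, flow_flow] using h1.tendsto p
  refine squeeze_zero (fun _ => norm_nonneg _) (fun q => ?_) h2
  have h3 := h.norm_flow_sub_flow_le hv q.1 t₀ q.2 (h.flow hv t₀ q.1 y)
  rwa [flow_flow, flow_self] at h3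

/-- By the cocycle identity the backward derivative is the inverse of a forward derivative, and
inversion is continuous at units. -/
theorem continuous_flowDeriv_symm (t₀ : ℝ) :
    Continuous (fun p : ℝ × E => h.flowDeriv hv p.1 t₀ p.2) := by
  have h1 : ∀ p : ℝ × E, h.flowDeriv hv p.1 t₀ p.2 ∘L
      h.flowDeriv hv t₀ p.1 (h.flow hv p.1 t₀ p.2) = ContinuousLinearMap.id ℝ E := fun p => by
    have := h.flowDeriv_comp hv t₀ p.1 t₀ (h.flow hv p.1 t₀ p.2)
    rwa [flow_flow, flow_self, flowDeriv_self] at this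
  have h2 : ∀ p : ℝ × E, h.flowDeriv hv t₀ p.1 (h.flow hv p.1 t₀ p.2) ∘L
      h.flowDeriv hv p.1 t₀ p.2 = ContinuousLinearMap.id ℝ E := fun p => by
    have := h.flowDeriv_comp hv p.1 t₀ p.1 p.2
    rwa [flowDeriv_self] at this
  let U : ℝ × E → (E →L[ℝ] E)ˣ := fun p =>
    ⟨h.flowDeriv hv t₀ p.1 (h.flow hv p.1 t₀ p.2), h.flowDeriv hv p.1 t₀ p.2, h2 p, h1 p⟩
  have h3 : (fun p : ℝ × E => h.flowDeriv hv p.1 t₀ p.2) =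
      fun p => Ring.inverse (h.flowDeriv hv t₀ p.1 (h.flow hv p.1 t₀ p.2)) :=
    funext fun p => (Ring.inverse_unit (U p)).symm
  rw [h3]
  refine continuous_iff_continuousAt.2 fun p => ?_
  exact ContinuousAt.comp (f := fun p : ℝ × E => h.flowDeriv hv t₀ p.1 (h.flow hv p.1 t₀ p.2))
    (NormedRing.inverse_continuousAt (U p))
    ((h.continuous_flowDeriv hv t₀).comp
      (continuous_fst.prodMk (h.continuous_flow_symm hv t₀))).continuousAt

theorem contDiff_flow (t₀ t : ℝ) : ContDiff ℝ 1 (h.flow hv t₀ t) := by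
  refine contDiff_one_iff_fderiv.2 ⟨fun x => (h.hasFDerivAt_flow hv t₀ t x).differentiableAt, ?_⟩
  have h1 : fderiv ℝ (h.flow hv t₀ t) = h.flowDeriv hv t₀ t :=
    funext fun x => (h.hasFDerivAt_flow hv t₀ t x).fderiv
  rw [h1]
  exact (h.continuous_flowDeriv hv t₀).comp (f := fun x : E => (t, x)) (by fun_prop)

/-- Liouville's formula. -/
theorem det_flowDeriv [FiniteDimensional ℝ E] (t₀ t : ℝ) (x : E) :
    (h.flowDeriv hv t₀ t x).det = Real.exp (∫ r in t₀..t,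
      LinearMap.trace ℝ E (fderiv ℝ (e (v r)) (h.flow hv t₀ r x) : E →ₗ[ℝ] E)) := by
  have : ProperSpace (E →L[ℝ] E) := FiniteDimensional.proper ℝ _
  -- With Jacobi's formula the chain rule turns the variational equation into a scalar linear
  -- equation for the determinant.
  have h1 := (h.isPrimitive_flowDeriv hv t₀ x).comp_contDiff contDiff_det
  simp only [fderiv_det_comp] at h1
  let tr : (E →L[ℝ] E) →ₗ[ℝ] ℝ := LinearMap.trace ℝ E ∘ₗ ContinuousLinearMap.coeLM ℝ
  have h2 : Integrable (fun r =>
      LinearMap.trace ℝ E (fderiv ℝ (e (v r)) (h.flow hv t₀ r x) : E →ₗ[ℝ] E)) :=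
    (LinearMap.toContinuousLinearMap tr).integrable_comp
      (h.integrable_fderiv hv (h.continuous_flow_time hv t₀ x))
  rw [h1.eq_mul_exp h2 t₀ t, flowDeriv_self,
    show (ContinuousLinearMap.id ℝ E).det = 1 from LinearMap.det_id, one_mul]

end IsC1Family

end FlowDerivative

section FirstOrder

/-! ### Eulerian and Lagrangian form of first-order equations -/

theorem intervalIntegrable_clm_apply {F G : Type*} [NormedAddCommGroup F] [NormedSpace ℝ F]
    [NormedAddCommGroup G] [NormedSpace ℝ G] {A : ℝ → F →L[ℝ] G} (hA : Continuous A) {u : ℝ → F}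
    (hu : Integrable u) (a b : ℝ) : IntervalIntegrable (fun r => A r (u r)) volume a b := by
  obtain ⟨M, hM⟩ := (isCompact_uIcc (a := a) (b := b)).exists_bound_of_continuousOn hA.continuousOn
  rw [intervalIntegrable_iff]
  refine (hu.norm.const_mul M).integrableOn.mono' ?_ ?_
  · exact (ContinuousLinearMap.apply ℝ G (E := F)).flip.aestronglyMeasurable_comp₂
      hA.aestronglyMeasurable hu.aestronglyMeasurable.restrict
  · refine (ae_restrict_iff' measurableSet_uIoc).2 (Eventually.of_forall fun r hr => ?_)
    exact ((A r).le_opNorm _).trans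
      (mul_le_mul_of_nonneg_right (hM r (uIoc_subset_uIcc hr)) (norm_nonneg _))

variable {V E : Type*} [NormedAddCommGroup V] [NormedSpace ℝ V]
  [NormedAddCommGroup E] [NormedSpace ℝ E]

/-- `f` is a time-dependent function on `U` with space derivative `f'`, both jointly continuous. -/
structure IsC1InSpace (U : Set E) (f : ℝ → E → ℝ) (f' : ℝ → E → E →L[ℝ] ℝ) : Prop where
  hasFDerivAt : ∀ t, ∀ x ∈ U, HasFDerivAt (f t) (f' t x) x
  continuousAt : ∀ p : ℝ × E, p.2 ∈ U → ContinuousAt (fun p : ℝ × E => f p.1 p.2) p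
  continuousAt_deriv : ∀ p : ℝ × E, p.2 ∈ U → ContinuousAt (fun p : ℝ × E => f' p.1 p.2) p

namespace IsC1InSpace

variable {U : Set E} {f : ℝ → E → ℝ} {f' : ℝ → E → E →L[ℝ] ℝ} (hf : IsC1InSpace U f f')

include hf

theorem continuous_comp {γ : ℝ → E} (hγ : Continuous γ) (hU : ∀ t, γ t ∈ U) :
    Continuous (fun t => f t (γ t)) :=
  continuous_iff_continuousAt.2 fun t =>
    ContinuousAt.comp (f := fun t => (t, γ t)) (g := fun p : ℝ × E => f p.1 p.2)
      (hf.continuousAt _ (hU t)) (by fun_prop)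

theorem continuous_deriv_comp {γ : ℝ → E} (hγ : Continuous γ) (hU : ∀ t, γ t ∈ U) :
    Continuous (fun t => f' t (γ t)) :=
  continuous_iff_continuousAt.2 fun t =>
    ContinuousAt.comp (f := fun t => (t, γ t)) (g := fun p : ℝ × E => f' p.1 p.2)
      (hf.continuousAt_deriv _ (hU t)) (by fun_prop)

end IsC1InSpace

namespace IsC1Family

variable {e : V →ₗ[ℝ] (E → E)} {C : ℝ} (h : IsC1Family e C) {v : ℝ → V} (hv : Integrable v)
  (q : (E →L[ℝ] E) →L[ℝ] ℝ) {U : Set E} {f : ℝ → E → ℝ} {f' : ℝ → E → E →L[ℝ] ℝ}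

include h hv

theorem integrable_const (x : E) : Integrable (fun r => e (v r) x) :=
  (h.isCaratheodory hv).integrable_comp (continuous_const (y := x)) fun _ => le_rfl

theorem intervalIntegrable_reaction (hf : IsC1InSpace U f f') {γ : ℝ → E} (hγ : Continuous γ)
    (hU : ∀ t, γ t ∈ U) (a b : ℝ) :
    IntervalIntegrable (fun r => f r (γ r) * q (fderiv ℝ (e (v r)) (γ r))) volume a b :=
  (q.integrable_comp (h.integrable_fderiv hv hγ)).intervalIntegrable.continuousOn_mul
    (hf.continuous_comp hγ hU).continuousOn

theorem intervalIntegrable_transport (hf : IsC1InSpace U f f') {x : E} (hx : x ∈ U) (a b : ℝ) :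
    IntervalIntegrable (fun r => f' r x (e (v r) x)) volume a b :=
  intervalIntegrable_clm_apply (hf.continuous_deriv_comp continuous_const fun _ => hx)
    (h.integrable_const hv x) a b

variable [CompleteSpace E]

/-- This replaces the chain rule. On a short step, moving from `x` along the flow at the fixed time
`t` changes `f` by nearly the transport integral at `x`, and the reaction integrals along the
trajectory and at `x` nearly agree. No time derivative of `f` enters. The error is uniform on the
compact set `K`. -/
theorem exists_increment_le (hU : IsOpen U) (hf : IsC1InSpace U f f')
    (hflow : ∀ s t, ∀ x ∈ U, h.flow hv s t x ∈ U) {K : Set E} (hK : IsCompact K) (hKU : K ⊆ U)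
    (a b : ℝ) {ε : ℝ} (hε : 0 < ε) :
    ∃ δ > 0, ∃ k : ℝ → ℝ, Integrable k ∧ (∀ r, 0 ≤ k r) ∧ ∫ r, k r ≤ ε ∧
      ∀ s t, a ≤ s → s ≤ t → t ≤ b → t - s ≤ δ → ∀ x ∈ K,
        ‖(f t (h.flow hv s t x) - f t x - ∫ r in s..t, f' r x (e (v r) x)) +
          ((∫ r in s..t, f r (h.flow hv s r x) * q (fderiv ℝ (e (v r)) (h.flow hv s r x))) -
            ∫ r in s..t, f r x * q (fderiv ℝ (e (v r)) x))‖ ≤ ∫ r in s..t, k r := by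
  have hK' : IsCompact (Icc a b ×ˢ K) := isCompact_Icc.prod hK
  obtain ⟨M₁, hM₁⟩ := hK'.exists_bound_of_continuousOn
    (f := fun p : ℝ × E => f p.1 p.2) fun p hp => (hf.continuousAt p (hKU hp.2)).continuousWithinAt
  obtain ⟨M₂, hM₂⟩ := hK'.exists_bound_of_continuousOn (f := fun p : ℝ × E => f' p.1 p.2)
    fun p hp => (hf.continuousAt_deriv p (hKU hp.2)).continuousWithinAt
  set M := max 0 (max M₁ M₂) with hM
  have hM0 : 0 ≤ M := le_max_left _ _
  have hMf : ∀ s ∈ Icc a b, ∀ x ∈ K, ‖f s x‖ ≤ M := fun s hs x hx =>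
    (hM₁ (s, x) ⟨hs, hx⟩).trans ((le_max_left _ _).trans (le_max_right _ _))
  have hMf' : ∀ s ∈ Icc a b, ∀ x ∈ K, ‖f' s x‖ ≤ M := fun s hs x hx =>
    (hM₂ (s, x) ⟨hs, hx⟩).trans ((le_max_right _ _).trans (le_max_right _ _))
  have hℓ : Integrable fun r => C * ‖v r‖ := hv.norm.const_mul C
  have hℓ0 : ∀ r, 0 ≤ C * ‖v r‖ := fun r => mul_nonneg h.nonneg (norm_nonneg _)
  set L := ∫ r, C * ‖v r‖ with hL
  have hL0 : 0 ≤ L := integral_nonneg hℓ0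
  set Q := ‖q‖ with hQ
  have hQ0 : 0 ≤ Q := norm_nonneg q
  -- Collects the coefficients of `η * C * ‖v r‖`: `1` from `term1`, `M + 1` from `term2`, `2 * Q`
  -- from `term3`.
  set N := M + 2 + 2 * Q with hN
  have hN0 : 0 < N := by positivity
  set η := ε / (2 * (N * (L + 1))) with hη
  have hη0 : 0 < η := by positivity
  obtain ⟨δ₁, hδ₁, hδ₁'⟩ := Metric.mem_uniformity_dist.1
    (hK'.uniformContinuousAt_of_continuousAt (fun p : ℝ × E => f p.1 p.2)
      (fun p hp => hf.continuousAt p (hKU hp.2)) (Metric.dist_mem_uniformity hη0))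
  obtain ⟨δ₂, hδ₂, hδ₂'⟩ := Metric.mem_uniformity_dist.1
    (hK'.uniformContinuousAt_of_continuousAt (fun p : ℝ × E => f' p.1 p.2)
      (fun p hp => hf.continuousAt_deriv p (hKU hp.2)) (Metric.dist_mem_uniformity hη0))
  obtain ⟨δ₃, hδ₃, hδ₃'⟩ := hK.exists_thickening_subset_open hU hKU
  obtain ⟨δ₄, hδ₄, k, hk, hk0, hkε, hmod⟩ := h.exists_fderiv_modulus hv
    (ε := ε / (2 * (M * Q + 1))) (by positivity)
  set d := min (min δ₁ δ₂) (min δ₃ (min δ₄ η)) with hd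
  have hd0 : 0 < d := by positivity
  have hd1 : d ≤ δ₁ := (min_le_left _ _).trans (min_le_left _ _)
  have hd2 : d ≤ δ₂ := (min_le_left _ _).trans (min_le_right _ _)
  have hd3 : d ≤ δ₃ := (min_le_right _ _).trans (min_le_left _ _)
  have hd4 : d ≤ δ₄ := (min_le_right _ _).trans ((min_le_right _ _).trans (min_le_left _ _))
  have hd5 : d ≤ η := (min_le_right _ _).trans ((min_le_right _ _).trans (min_le_right _ _))
  obtain ⟨τ, hτ, hτ'⟩ := Metric.uniformContinuousOn_iff.1
    (isCompact_Icc.uniformContinuousOn_of_continuous (s := Icc a b)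
      (isPrimitive_integral hℓ a).continuous.continuousOn) d hd0
  -- `τ` keeps the displacement along the flow below `d`, and `d / 2` keeps the time increment below
  -- `d`.
  refine ⟨min (τ / 2) (d / 2), by positivity,
    fun r => (N * η) * (C * ‖v r‖) + (M * Q) * k r, (hℓ.const_mul _).add (hk.const_mul _),
    fun r => add_nonneg (mul_nonneg (by positivity) (hℓ0 r)) (mul_nonneg (by positivity) (hk0 r)),
    ?_, ?_⟩
  · rw [integral_add (hℓ.const_mul _) (hk.const_mul _), integral_const_mul (N * η),
      integral_const_mul (M * Q), ← hL]
    have h1 : N * η * L ≤ ε / 2 := by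
      rw [hη, show N * (ε / (2 * (N * (L + 1)))) * L = ε / 2 * (L / (L + 1)) by field_simp]
      exact mul_le_of_le_one_right (by positivity) ((div_le_one (by linarith)).2 (by linarith))
    have h2 : M * Q * ∫ r, k r ≤ ε / 2 := by
      have hMQ : 0 ≤ M * Q := by positivity
      refine (mul_le_mul_of_nonneg_left hkε hMQ).trans ?_
      rw [show M * Q * (ε / (2 * (M * Q + 1))) = ε / 2 * (M * Q / (M * Q + 1)) by field_simp]
      exact mul_le_of_le_one_right (by positivity) ((div_le_one (by linarith)).2 (by linarith))
    linarith
  intro s t has hst htb hts x hx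
  have hsI : s ∈ Icc a b := ⟨has, hst.trans htb⟩
  have htime : ∀ r ∈ Icc s t, dist r s < d := fun r hr => by
    rw [Real.dist_eq, abs_of_nonneg (by linarith [hr.1])]
    linarith [hr.2, hts.trans (min_le_right _ _)]
  set γ : ℝ → E := fun r => h.flow hv s r x with hγ
  have hγp := h.isPrimitive_flow hv s x
  have hγU : ∀ r, γ r ∈ U := fun r => hflow s r x (hKU hx)
  have hγ1 : ∀ r ∈ Icc s t, ‖γ r - x‖ ≤ ∫ r in s..t, C * ‖v r‖ := fun r hr => by
    have h1 := hγp.norm_sub_le hℓ (fun r => h.norm_le _ _) s r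
    rw [flow_self, abs_of_nonneg (intervalIntegral.integral_nonneg hr.1 fun r _ => hℓ0 r)] at h1
    refine h1.trans ?_
    rw [← intervalIntegral.integral_add_adjacent_intervals (b := r)
        hℓ.intervalIntegrable hℓ.intervalIntegrable (c := t)]
    exact le_add_of_nonneg_right (intervalIntegral.integral_nonneg hr.2 fun r _ => hℓ0 r)
  have hℓd : ∫ r in s..t, C * ‖v r‖ < d := by
    have h1 := hτ' t ⟨has.trans hst, htb⟩ s hsI (by
      rw [Real.dist_eq, abs_of_nonneg (by linarith)]
      linarith [hts.trans (min_le_left _ _)])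
    rw [dist_eq_norm, (isPrimitive_integral hℓ a).2] at h1
    exact (le_abs_self _).trans_lt h1
  have hγd : ∀ r ∈ Icc s t, ‖γ r - x‖ < d := fun r hr => (hγ1 r hr).trans_lt hℓd
  have hnear : ∀ r ∈ Icc s t, ∀ z, ‖z - x‖ < d → dist (s, x) (r, z) < d := fun r hr z hz => by
    rw [dist_comm, Prod.dist_eq]
    exact max_lt (htime r hr) (by rw [dist_eq_norm]; exact hz)
  have hfn : ∀ r ∈ Icc s t, ∀ z, ‖z - x‖ < d → ‖f r z - f s x‖ ≤ η := fun r hr z hz => by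
    have h1 := hδ₁' ((hnear r hr z hz).trans_le hd1) ⟨hsI, hx⟩
    rw [← dist_eq_norm, dist_comm]
    exact le_of_lt h1
  have hfn' : ∀ r ∈ Icc s t, ∀ z, ‖z - x‖ < d → ‖f' r z - f' s x‖ ≤ η := fun r hr z hz => by
    have h1 := hδ₂' ((hnear r hr z hz).trans_le hd2) ⟨hsI, hx⟩
    rw [← dist_eq_norm, dist_comm]
    exact le_of_lt h1
  have hxx : ‖x - x‖ < d := by rwa [sub_self, norm_zero]
  have htI : t ∈ Icc s t := ⟨hst, le_rfl⟩
  have term1 : ‖f t (γ t) - f t x - f' s x (γ t - x)‖ ≤ η * ∫ r in s..t, C * ‖v r‖ := by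
    refine ((convex_ball x d).norm_image_sub_le_of_norm_hasFDerivWithin_le'
      (fun z hz => (hf.hasFDerivAt t z (hδ₃' (Metric.mem_thickening_iff.2
        ⟨x, hx, lt_of_lt_of_le hz hd3⟩))).hasFDerivWithinAt)
      (fun z hz => hfn' t htI z (by rw [← dist_eq_norm]; exact hz)) (Metric.mem_ball_self hd0)
      (Metric.mem_ball.2 (by rw [dist_eq_norm]; exact hγd t htI))).trans
      (mul_le_mul_of_nonneg_left (hγ1 t htI) hη0.le)
  have term2 : ‖f' s x (γ t - x) - ∫ r in s..t, f' r x (e (v r) x)‖ ≤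
      ∫ r in s..t, ((M + 1) * η) * (C * ‖v r‖) := by
    have h1 : γ t - x = ∫ r in s..t, e (v r) (γ r) := by
      rw [← hγp.2 s t]
      simp [hγ]
    rw [h1, ← ContinuousLinearMap.intervalIntegral_comp_comm _ hγp.1.intervalIntegrable,
      ← intervalIntegral.integral_sub ((f' s x).integrable_comp hγp.1).intervalIntegrable
        (h.intervalIntegrable_transport hv hf (hKU hx) s t)]
    refine intervalIntegral.norm_integral_le_of_norm_le hst (Eventually.of_forall fun r hr => ?_)
      (hℓ.const_mul _).intervalIntegrable
    have hr' : r ∈ Icc s t := ⟨hr.1.le, hr.2⟩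
    have h2 : f' s x (e (v r) (γ r)) - f' r x (e (v r) x) =
        f' s x (e (v r) (γ r) - e (v r) x) - (f' r x - f' s x) (e (v r) x) := by
      rw [map_sub, sub_apply]; ring
    rw [h2]
    have h3 : ‖f' s x (e (v r) (γ r) - e (v r) x)‖ ≤ M * (C * ‖v r‖ * η) :=
      (ContinuousLinearMap.le_opNorm _ _).trans (mul_le_mul (hMf' s hsI x hx)
        ((h.norm_map_sub_le _ _ _).trans (mul_le_mul_of_nonneg_left
          ((hγd r hr').le.trans hd5) (hℓ0 r))) (norm_nonneg _) hM0)
    have h4 : ‖(f' r x - f' s x) (e (v r) x)‖ ≤ η * (C * ‖v r‖) :=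
      (ContinuousLinearMap.le_opNorm _ _).trans (mul_le_mul (hfn' r hr' x hxx)
        (h.norm_le _ _) (norm_nonneg _) hη0.le)
    refine (norm_sub_le _ _).trans ((add_le_add h3 h4).trans (le_of_eq ?_))
    ring
  have term3 : ‖(∫ r in s..t, f r (γ r) * q (fderiv ℝ (e (v r)) (γ r))) -
      ∫ r in s..t, f r x * q (fderiv ℝ (e (v r)) x)‖ ≤
      ∫ r in s..t, ((2 * Q * η) * (C * ‖v r‖) + (M * Q) * k r) := by
    rw [← intervalIntegral.integral_sub
      (h.intervalIntegrable_reaction hv q hf hγp.continuous hγU s t)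
      (h.intervalIntegrable_reaction hv q hf (continuous_const (y := x)) (fun _ => hKU hx) s t)]
    refine intervalIntegral.norm_integral_le_of_norm_le hst (Eventually.of_forall fun r hr => ?_)
      ((hℓ.const_mul _).add (hk.const_mul _)).intervalIntegrable
    have hr' : r ∈ Icc s t := ⟨hr.1.le, hr.2⟩
    have h2 : f r (γ r) * q (fderiv ℝ (e (v r)) (γ r)) - f r x * q (fderiv ℝ (e (v r)) x) =
        ((f r (γ r) - f s x) - (f r x - f s x)) * q (fderiv ℝ (e (v r)) (γ r)) +
        f r x * q (fderiv ℝ (e (v r)) (γ r) - fderiv ℝ (e (v r)) x) := by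
      rw [map_sub]; ring
    have h3 : ‖(f r (γ r) - f s x) - (f r x - f s x)‖ ≤ η + η :=
      (norm_sub_le _ _).trans (add_le_add (hfn r hr' _ (hγd r hr')) (hfn r hr' x hxx))
    have h4 : ‖q (fderiv ℝ (e (v r)) (γ r))‖ ≤ Q * (C * ‖v r‖) :=
      (q.le_opNorm _).trans (mul_le_mul_of_nonneg_left (h.norm_fderiv_le _ _) hQ0)
    have h5 : ‖q (fderiv ℝ (e (v r)) (γ r) - fderiv ℝ (e (v r)) x)‖ ≤ Q * k r :=
      (q.le_opNorm _).trans (mul_le_mul_of_nonneg_left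
        (hmod r _ _ ((hγd r hr').le.trans hd4)) hQ0)
    rw [h2]
    refine (norm_add_le _ _).trans ?_
    rw [norm_mul, norm_mul]
    refine (add_le_add (mul_le_mul h3 h4 (norm_nonneg _) (by positivity))
      (mul_le_mul (hMf r ⟨has.trans hr'.1, hr'.2.trans htb⟩ x hx) h5 (norm_nonneg _) hM0)).trans
      (le_of_eq ?_)
    ring
  have hsplit : (f t (γ t) - f t x - ∫ r in s..t, f' r x (e (v r) x)) =
      (f t (γ t) - f t x - f' s x (γ t - x)) +
        (f' s x (γ t - x) - ∫ r in s..t, f' r x (e (v r) x)) := by ring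
  rw [hsplit]
  refine (norm_add_le _ _).trans ((add_le_add ((norm_add_le _ _).trans
    (add_le_add term1 term2)) term3).trans (le_of_eq ?_))
  rw [intervalIntegral.integral_add (hℓ.const_mul _).intervalIntegrable
      (hk.const_mul _).intervalIntegrable,
    intervalIntegral.integral_add (hℓ.const_mul _).intervalIntegrable
      (hk.const_mul _).intervalIntegrable]
  simp only [intervalIntegral.integral_const_mul, hN]
  ring

/-- From the Lagrangian to the Eulerian form of an equation `∂ₜ f + ⟨∇f, v⟩ + f q(Dv) = 0`. -/
theorem eulerian_of_lagrangian (hU : IsOpen U) (hf : IsC1InSpace U f f')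
    (hflow : ∀ s t, ∀ x ∈ U, h.flow hv s t x ∈ U) {a b : ℝ}
    (hlag : ∀ y ∈ U, ∀ s t, a ≤ s → s ≤ t → t ≤ b →
      f t (h.flow hv a t y) - f s (h.flow hv a s y) =
        -∫ r in s..t, f r (h.flow hv a r y) * q (fderiv ℝ (e (v r)) (h.flow hv a r y)))
    {x : E} (hx : x ∈ U) (hab : a ≤ b) :
    f b x = f a x - ∫ r in a..b, (f' r x (e (v r) x) + f r x * q (fderiv ℝ (e (v r)) x)) := by
  have hi1 : ∀ s t, IntervalIntegrable (fun r => f' r x (e (v r) x)) volume s t :=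
    h.intervalIntegrable_transport hv hf hx
  have hi2 : ∀ s t, IntervalIntegrable (fun r => f r x * q (fderiv ℝ (e (v r)) x)) volume s t :=
    h.intervalIntegrable_reaction hv q hf (continuous_const (y := x)) fun _ => hx
  have hi : ∀ s t, IntervalIntegrable
      (fun r => f' r x (e (v r) x) + f r x * q (fderiv ℝ (e (v r)) x)) volume s t :=
    fun s t => (hi1 s t).add (hi2 s t)
  have key := eq_of_local_increments (f := fun t => f t x +
    ∫ r in a..t, (f' r x (e (v r) x) + f r x * q (fderiv ℝ (e (v r)) x))) hab fun ε hε => ?_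
  · simp only [intervalIntegral.integral_same, add_zero] at key
    linarith
  obtain ⟨δ, hδ, k, hk, hk0, hkε, hinc⟩ := h.exists_increment_le hv q hU hf hflow
    (isCompact_singleton (x := x)) (singleton_subset_iff.2 hx) a b hε
  refine ⟨δ, hδ, k, hk, hk0, hkε, fun s t has hst htb hts => ?_⟩
  have h1 := hinc s t has hst htb hts x rfl
  -- The trajectory that passes through `x` at time `s` starts at `flow s a x`.
  have h2 := hlag (h.flow hv s a x) (hflow _ _ _ hx) s t has hst htb
  simp only [flow_flow, flow_self] at h2
  have h3 := intervalIntegral.integral_add_adjacent_intervals (hi a s) (hi s t)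
  have h4 := intervalIntegral.integral_add (hi1 s t) (hi2 s t)
  rw [← norm_neg]
  refine le_of_eq_of_le (congrArg _ ?_) h1
  linarith

/-- From the Eulerian to the Lagrangian form of an equation `∂ₜ f + ⟨∇f, v⟩ + f q(Dv) = 0`. -/
theorem lagrangian_of_eulerian (hU : IsOpen U) (hf : IsC1InSpace U f f')
    (hflow : ∀ s t, ∀ x ∈ U, h.flow hv s t x ∈ U) {a b : ℝ}
    (heul : ∀ x ∈ U, ∀ t ∈ Icc a b,
      f t x = f a x - ∫ r in a..t, (f' r x (e (v r) x) + f r x * q (fderiv ℝ (e (v r)) x)))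
    {y : E} (hy : y ∈ U) {t : ℝ} (ht : t ∈ Icc a b) :
    f t (h.flow hv a t y) = f a y -
      ∫ r in a..t, f r (h.flow hv a r y) * q (fderiv ℝ (e (v r)) (h.flow hv a r y)) := by
  have hγ := h.continuous_flow_time hv a y
  have hγU : ∀ t, h.flow hv a t y ∈ U := fun t => hflow a t y hy
  have hir := h.intervalIntegrable_reaction hv q hf hγ hγU
  have key := eq_of_local_increments (f := fun t => f t (h.flow hv a t y) +
    ∫ r in a..t, f r (h.flow hv a r y) * q (fderiv ℝ (e (v r)) (h.flow hv a r y))) ht.1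
    fun ε hε => ?_
  · simp only [intervalIntegral.integral_same, add_zero, flow_self] at key
    linarith
  -- The base point is the position at time `s`, so the estimate has to be uniform over the whole
  -- trajectory, a compact set. The Eulerian equation is then used at that fixed point between `s`
  -- and `t'`.
  obtain ⟨δ, hδ, k, hk, hk0, hkε, hinc⟩ := h.exists_increment_le hv q hU hf hflow
    (isCompact_Icc.image_of_continuousOn (s := Icc a b) hγ.continuousOn)
    (image_subset_iff.2 fun t _ => hγU t) a b hε
  refine ⟨δ, hδ, k, hk, hk0, hkε, fun s t' has hst htb hts => ?_⟩
  have htb' := htb.trans ht.2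
  set x := h.flow hv a s y with hx
  have hxU : x ∈ U := hγU s
  have h1 := hinc s t' has hst htb' hts x ⟨s, ⟨has, hst.trans htb'⟩, rfl⟩
  simp only [hx, flow_flow] at h1
  rw [← hx] at h1
  have hi1 : ∀ s t, IntervalIntegrable (fun r => f' r x (e (v r) x)) volume s t :=
    h.intervalIntegrable_transport hv hf hxU
  have hi2 : ∀ s t, IntervalIntegrable (fun r => f r x * q (fderiv ℝ (e (v r)) x)) volume s t :=
    h.intervalIntegrable_reaction hv q hf (continuous_const (y := x)) fun _ => hxU
  have h2 := heul x hxU s ⟨has, hst.trans htb'⟩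
  have h3 := heul x hxU t' ⟨has.trans hst, htb'⟩
  have h4 := intervalIntegral.integral_add_adjacent_intervals ((hi1 a s).add (hi2 a s))
    ((hi1 s t').add (hi2 s t'))
  have h5 := intervalIntegral.integral_add (hi1 s t') (hi2 s t')
  have h6 := intervalIntegral.integral_add_adjacent_intervals (hir a s) (hir s t')
  refine le_of_eq_of_le (congrArg _ ?_) h1
  linarith

end IsC1Family

end FirstOrder

section Extension

variable {n : ℕ} {Ω : TopologicalSpace.Opens (Euc n)}

/-! ### Extension by zero -/

section ExtendZero

variable {F : Type*}

theorem extendZero_of_mem [Zero F] (u : Ω → F) {x : Euc n} (hx : x ∈ Ω) :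
    extendZero u x = u ⟨x, hx⟩ := dif_pos hx

@[simp]
theorem extendZero_coe [Zero F] (u : Ω → F) (x : Ω) : extendZero u x = u x := dif_pos x.2

theorem extendZero_of_notMem [Zero F] (u : Ω → F) {x : Euc n} (hx : x ∉ Ω) :
    extendZero u x = 0 := dif_neg hx

theorem extendZero_eventuallyEq [Zero F] {u : Ω → F} {g : Euc n → F} (h : ∀ x : Ω, u x = g x)
    {x : Euc n} (hx : x ∈ Ω) : extendZero u =ᶠ[𝓝 x] g := by
  filter_upwards [Ω.isOpen.mem_nhds hx] with y hy
  rw [extendZero_of_mem u hy, h]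

variable [NormedAddCommGroup F]

theorem exists_isCompact_norm_extendZero_lt {u : Ω → F} (hu : Tendsto u (cocompact Ω) (𝓝 0))
    {ε : ℝ} (hε : 0 < ε) :
    ∃ K : Set (Euc n), IsCompact K ∧ K ⊆ Ω ∧ ∀ x ∉ K, ‖extendZero u x‖ < ε := by
  obtain ⟨K, hK, hKu⟩ := mem_cocompact.1 (hu (Metric.ball_mem_nhds 0 hε))
  refine ⟨(↑) '' K, hK.image continuous_subtype_val, by rintro _ ⟨x, -, rfl⟩; exact x.2,
    fun x hx => ?_⟩
  by_cases hxΩ : x ∈ Ω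
  · rw [extendZero_of_mem u hxΩ]
    have h1 : (⟨x, hxΩ⟩ : Ω) ∈ Kᶜ := fun h => hx ⟨_, h, rfl⟩
    simpa using hKu h1
  · rwa [extendZero_of_notMem u hxΩ, norm_zero]

theorem tendsto_extendZero_cocompact {u : Ω → F} (hu : Tendsto u (cocompact Ω) (𝓝 0)) :
    Tendsto (extendZero u) (cocompact (Euc n)) (𝓝 0) := by
  refine Metric.tendsto_nhds.2 fun ε hε => ?_
  obtain ⟨K, hK, -, hKε⟩ := exists_isCompact_norm_extendZero_lt hu hε
  filter_upwards [hK.compl_mem_cocompact] with x hx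
  rw [dist_zero_right]
  exact hKε x hx

theorem continuousAt_extendZero_of_notMem {u : Ω → F} (hu : Tendsto u (cocompact Ω) (𝓝 0))
    {x : Euc n} (hx : x ∉ Ω) : ContinuousAt (extendZero u) x := by
  refine Metric.tendsto_nhds.2 fun ε hε => ?_
  obtain ⟨K, hK, hKΩ, hKε⟩ := exists_isCompact_norm_extendZero_lt hu hε
  filter_upwards [hK.isClosed.isOpen_compl.mem_nhds fun h => hx (hKΩ h)] with y hy
  rw [extendZero_of_notMem u hx, dist_zero_right]
  exact hKε y hy

variable [NormedSpace ℝ F]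

theorem IsC1.hasFDerivAt {u : Ω → F} (hu : IsC1 u) (x : Ω) :
    HasFDerivAt (extendZero u) (jac u x) (x : Euc n) :=
  ((hu.differentiableOn one_ne_zero).differentiableAt (Ω.isOpen.mem_nhds x.2)).hasFDerivAt

theorem IsC1.continuousOn_fderiv {u : Ω → F} (hu : IsC1 u) :
    ContinuousOn (fderiv ℝ (extendZero u)) Ω :=
  hu.continuousOn_fderiv_of_isOpen Ω.isOpen le_rfl

theorem IsC1.continuous {u : Ω → F} (hu : IsC1 u) : Continuous u := by
  have h := continuousOn_iff_continuous_domRestrict.1 hu.continuousOn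
  exact h.congr fun x => extendZero_coe u x

theorem IsC1.continuous_jac {u : Ω → F} (hu : IsC1 u) : Continuous (jac u) :=
  continuousOn_iff_continuous_domRestrict.1 hu.continuousOn_fderiv

/-- Along a segment that starts in `Ω` and ends outside, `u` is controlled by its derivative on
the part of the segment up to the boundary. -/
theorem norm_extendZero_le_of_segment {u : Ω → F} (hu : IsC1 u)
    (hu0 : Tendsto u (cocompact Ω) (𝓝 0)) {x y : Euc n} (hy : y ∉ Ω) {ε : ℝ} (hε : 0 ≤ ε)
    (hε' : ∀ z ∈ segment ℝ x y, ‖extendZero (jac u) z‖ ≤ ε) :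
    ‖extendZero u x‖ ≤ ε * ‖x - y‖ := by
  let c : ℝ → Euc n := fun τ => x + τ • (y - x)
  have hc : Continuous c := by fun_prop
  have hgc : Continuous (extendZero u) := continuous_iff_continuousAt.2 fun z => by
    by_cases hz : z ∈ Ω
    · exact hu.continuousOn.continuousAt (Ω.isOpen.mem_nhds hz)
    · exact continuousAt_extendZero_of_notMem hu0 hz
  let S : Set ℝ := Icc 0 1 ∩ c ⁻¹' (Ω : Set (Euc n))ᶜ
  have hS : IsCompact S := isCompact_Icc.inter_right (Ω.isOpen.isClosed_compl.preimage hc)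
  have hSne : S.Nonempty := ⟨1, ⟨zero_le_one, le_rfl⟩, by simpa [c] using hy⟩
  -- The first exit time from `Ω`: there `u` vanishes, and before it the derivative is available.
  set τ := sInf S
  have hτS : τ ∈ S := hS.sInf_mem hSne
  have hlt : ∀ r ∈ Ico 0 τ, c r ∈ Ω := fun r hr => by
    by_contra hn
    exact (notMem_of_lt_csInf hr.2 hS.bddBelow) ⟨⟨hr.1, hr.2.le.trans hτS.1.2⟩, hn⟩
  have key := norm_image_sub_le_of_norm_deriv_right_le_segment (a := 0) (b := τ)
    (f := extendZero u ∘ c) (f' := fun r => extendZero (jac u) (c r) (y - x))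
    (C := ε * ‖y - x‖) (hgc.comp hc).continuousOn (fun r hr => ?_) (fun r hr => ?_) τ
    ⟨hτS.1.1, le_rfl⟩
  · have h1 : (extendZero u ∘ c) τ = 0 := extendZero_of_notMem u hτS.2
    have h2 : (extendZero u ∘ c) 0 = extendZero u x := by simp [c]
    rw [h1, h2, zero_sub, norm_neg, sub_zero, norm_sub_rev y x] at key
    exact key.trans (mul_le_of_le_one_right (by positivity) hτS.1.2)
  · have h1 : HasDerivAt c (y - x) r := by
      simpa [c] using ((hasDerivAt_id r).smul_const (y - x)).const_add x
    have h2 := (hu.hasFDerivAt ⟨c r, hlt r hr⟩).comp_hasDerivAt r h1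
    rw [extendZero_of_mem (jac u) (hlt r hr)]
    exact h2.hasDerivWithinAt
  · refine (ContinuousLinearMap.le_opNorm _ _).trans
      (mul_le_mul_of_nonneg_right (hε' _ ?_) (norm_nonneg _))
    rw [segment_eq_image']
    exact ⟨r, ⟨hr.1, hr.2.le.trans hτS.1.2⟩, rfl⟩

end ExtendZero

namespace IsC1Zero

variable {u : Ω → Euc n} (hu : IsC1Zero u)

include hu

/-- At `x ∉ Ω` the derivative is zero: the Jacobian is smaller than `ε` off a compact subset of `Ω`,
hence near `x`, and the mean value inequality on the segment to `x` bounds `u y` by `ε * ‖y - x‖`.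
-/
theorem hasFDerivAt_extendZero (x : Euc n) :
    HasFDerivAt (extendZero u) (extendZero (jac u) x) x := by
  by_cases hx : x ∈ Ω
  · rw [extendZero_of_mem _ hx]
    exact hu.1.hasFDerivAt ⟨x, hx⟩
  rw [extendZero_of_notMem _ hx]
  refine .of_isLittleO (Asymptotics.isLittleO_iff.2 fun ε hε => ?_)
  obtain ⟨K, hK, hKΩ, hKε⟩ := exists_isCompact_norm_extendZero_lt hu.2.2 hε
  obtain ⟨r, hr, hrK⟩ := Metric.mem_nhds_iff.1
    (hK.isClosed.isOpen_compl.mem_nhds fun h => hx (hKΩ h))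
  filter_upwards [Metric.ball_mem_nhds x hr] with y hy
  rw [extendZero_of_notMem u hx, sub_zero, zero_apply, sub_zero]
  refine norm_extendZero_le_of_segment hu.1 hu.2.1 hx hε.le fun z hz => (hKε z ?_).le
  exact hrK ((convex_ball x r).segment_subset hy (Metric.mem_ball_self hr) hz)

theorem fderiv_extendZero : fderiv ℝ (extendZero u) = extendZero (jac u) :=
  funext fun x => (hu.hasFDerivAt_extendZero x).fderiv

theorem continuous_fderiv : Continuous (fderiv ℝ (extendZero u)) :=
  continuous_iff_continuousAt.2 fun x => by
    by_cases hx : x ∈ Ω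
    · exact hu.1.continuousOn_fderiv.continuousAt (Ω.isOpen.mem_nhds hx)
    · rw [hu.fderiv_extendZero]
      exact continuousAt_extendZero_of_notMem hu.2.2 hx

theorem contDiff_extendZero : ContDiff ℝ 1 (extendZero u) :=
  contDiff_one_iff_fderiv.2
    ⟨fun x => (hu.hasFDerivAt_extendZero x).differentiableAt, hu.continuous_fderiv⟩

theorem uniformContinuous_fderiv : UniformContinuous (fderiv ℝ (extendZero u)) :=
  hu.continuous_fderiv.uniformContinuous_of_tendsto_cocompact (x := 0) (by
    rw [hu.fderiv_extendZero]
    exact tendsto_extendZero_cocompact hu.2.2)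

end IsC1Zero

/-! ### Admissible spaces -/

section Admissible

variable {V : Type*} [NormedAddCommGroup V] [InnerProductSpace ℝ V]

/-- The fields of an admissible space, extended by zero to the whole space. -/
def extendedField (ev : V →ₗ[ℝ] (Ω → Euc n)) : V →ₗ[ℝ] (Euc n → Euc n) where
  toFun u := extendZero (ev u)
  map_add' u u' := by
    ext1 x
    by_cases hx : x ∈ Ω <;> simp [extendZero, hx]
  map_smul' c u := by
    ext1 x
    by_cases hx : x ∈ Ω <;> simp [extendZero, hx]

variable {ev : V →ₗ[ℝ] (Ω → Euc n)} (hV : IsAdmissible ev)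

theorem extendedField_apply (u : V) : extendedField ev u = extendZero (ev u) := rfl

/-- The constant of an admissible space. -/
def IsAdmissible.const : ℝ := hV.bound.choose

theorem IsAdmissible.isC1Family : IsC1Family (extendedField ev) hV.const := by
  obtain ⟨hC, hbound⟩ := hV.bound.choose_spec
  have h0 : ∀ u : V, 0 ≤ hV.bound.choose * ‖u‖ := fun u => mul_nonneg hC.le (norm_nonneg _)
  refine ⟨hC.le, fun u => (hV.isC1Zero u).contDiff_extendZero, fun u x => ?_, fun u x => ?_,
    fun u => (hV.isC1Zero u).uniformContinuous_fderiv⟩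
  · rw [extendedField_apply]
    by_cases hx : x ∈ Ω
    · rw [extendZero_of_mem _ hx]
      exact (le_add_of_nonneg_right (norm_nonneg _)).trans (hbound u ⟨x, hx⟩ ⟨x, hx⟩)
    · rw [extendZero_of_notMem _ hx, norm_zero]
      exact h0 u
  · rw [extendedField_apply, (hV.isC1Zero u).fderiv_extendZero]
    by_cases hx : x ∈ Ω
    · rw [extendZero_of_mem _ hx]
      exact (le_add_of_nonneg_left (norm_nonneg _)).trans (hbound u ⟨x, hx⟩ ⟨x, hx⟩)
    · rw [extendZero_of_notMem _ hx, norm_zero]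
      exact h0 u

/-! ### Time on the unit interval and on the real line -/

/-- The extension by zero of a velocity field to all times. -/
def velocityExt (v : I → V) : ℝ → V :=
  (Icc (0 : ℝ) 1).indicator (fun t => v (projIcc 0 1 zero_le_one t))

omit [InnerProductSpace ℝ V] in
@[simp]
theorem velocityExt_coe (v : I → V) (t : I) : velocityExt v t = v t := by
  rw [velocityExt, indicator_of_mem t.2, projIcc_val]

omit [InnerProductSpace ℝ V] in
theorem velocityExt_of_notMem (v : I → V) {t : ℝ} (ht : t ∉ Icc (0 : ℝ) 1) :
    velocityExt v t = 0 := indicator_of_notMem ht _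

section Time

variable {F : Type*} [NormedAddCommGroup F]

theorem integrableOn_unitInterval_iff {H : ℝ → F} {k : I → F} (hH : ∀ s : I, H s = k s) :
    IntegrableOn H (Icc 0 1) ↔ Integrable k := by
  have h1 := unitInterval.measurePreserving_coe.integrable_comp_emb
    unitInterval.measurableEmbedding_coe (g := H)
  rw [show H ∘ ((↑) : I → ℝ) = k from funext hH] at h1
  exact h1.symm

theorem integrable_of_zero_off {H : ℝ → F} (hH : IntegrableOn H (Icc 0 1))
    (h0 : ∀ t ∉ Icc (0 : ℝ) 1, H t = 0) : Integrable H :=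
  (integrableOn_iff_integrable_of_support_subset fun t ht => by
    by_contra h
    exact ht (h0 t h)).1 hH

omit [InnerProductSpace ℝ V] in
theorem integrable_velocityExt (v : Velocity V) : Integrable (velocityExt v) := by
  refine integrable_of_zero_off ((integrableOn_unitInterval_iff (velocityExt_coe v)).2 ?_)
    fun t => velocityExt_of_notMem v
  exact (Lp.memLp v).integrable one_le_two

variable [NormedSpace ℝ F]

theorem setIntegral_Iic_eq {H : ℝ → F} {k : I → F} (hH : ∀ s : I, H s = k s) (t : I) :
    ∫ s in Iic t, k s = ∫ s in (0 : ℝ)..t, H s := by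
  have h1 := unitInterval.measurePreserving_coe.setIntegral_preimage_emb
    unitInterval.measurableEmbedding_coe H (Iic (t : ℝ))
  have h2 : ((↑) : I → ℝ) ⁻¹' Iic (t : ℝ) = Iic t := rfl
  rw [h2, Measure.restrict_restrict measurableSet_Iic] at h1
  have h3 : Iic (t : ℝ) ∩ I = Icc 0 (t : ℝ) := by
    ext s
    simp only [mem_inter_iff, mem_Iic, unitInterval, mem_Icc]
    exact ⟨fun h => ⟨h.2.1, h.1⟩, fun h => ⟨h.2, h.1, h.2.trans t.2.2⟩⟩
  rw [h3, integral_Icc_eq_integral_Ioc, ← intervalIntegral.integral_of_le t.2.1] at h1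
  simpa only [hH] using h1

/-- Lets an integral equation on `[0,1]` be continued to the real line by freezing the solution
outside. -/
theorem intervalIntegral_projIcc {H : ℝ → F} (hH : Integrable H)
    (h0 : ∀ t ∉ Icc (0 : ℝ) 1, H t = 0) (t : ℝ) :
    ∫ s in (0 : ℝ)..t, H s = ∫ s in (0 : ℝ)..(projIcc 0 1 zero_le_one t : I), H s := by
  -- For `t < 0` the interval of integration meets `[0,1]` in the null set `{0}`.
  have hae : ∀ᵐ s : ℝ, s ≠ 0 := Measure.ae_ne volume 0
  rcases lt_or_ge t 0 with ht | ht
  · rw [projIcc_of_le_left _ ht.le, intervalIntegral.integral_same]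
    refine intervalIntegral.integral_zero_ae ?_
    filter_upwards [hae] with s hs hst
    rw [uIoc_of_ge ht.le] at hst
    exact h0 s fun h => hs (le_antisymm hst.2 h.1)
  rcases le_or_gt t 1 with ht1 | ht1
  · rw [projIcc_of_mem _ ⟨ht, ht1⟩]
  · rw [projIcc_of_right_le _ ht1.le, ← intervalIntegral.integral_add_adjacent_intervals (b := 1)
      hH.intervalIntegrable hH.intervalIntegrable]
    have h1 : ∫ s in (1 : ℝ)..t, H s = 0 := by
      refine intervalIntegral.integral_zero_ae (Eventually.of_forall fun s hs => ?_)
      rw [uIoc_of_le ht1.le] at hs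
      exact h0 s fun h => absurd h.2 (not_le.2 hs.1)
    rw [h1, add_zero]

end Time

end Admissible

end Extension

section AdmissibleFlow

variable {n : ℕ} {Ω : TopologicalSpace.Opens (Euc n)}
  {V : Type*} [NormedAddCommGroup V] [InnerProductSpace ℝ V]
  {ev : V →ₗ[ℝ] (Ω → Euc n)}

/-! ### The flow of a velocity field -/

theorem Diffeo.ext {φ ψ : Diffeo Ω} (h : ∀ x, φ.toEquiv x = ψ.toEquiv x) : φ = ψ := by
  obtain ⟨e₁, _, _⟩ := φ
  obtain ⟨e₂, _, _⟩ := ψ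
  obtain rfl : e₁ = e₂ := Equiv.ext h
  rfl

theorem isC1_of_contDiff {F : Type*} [NormedAddCommGroup F] [NormedSpace ℝ F] {g : Euc n → F}
    (hg : ContDiff ℝ 1 g) {u : Ω → F} (hu : ∀ x : Ω, u x = g x) : IsC1 u :=
  hg.contDiffOn.congr fun x hx => by rw [extendZero_of_mem u hx, hu]

namespace IsAdmissible

variable (hV : IsAdmissible ev) (v : Velocity V)

/-- The flow on the whole space, from time `s` to time `t`. -/
def flow (s t : ℝ) (x : Euc n) : Euc n :=
  hV.isC1Family.flow (integrable_velocityExt v) s t x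

/-- The derivative in space of the flow. -/
def flowDeriv (s t : ℝ) (x : Euc n) : Euc n →L[ℝ] Euc n :=
  hV.isC1Family.flowDeriv (integrable_velocityExt v) s t x

/-- The extended field vanishes off `Ω`, so a constant curve is the trajectory there. Consequently
no trajectory can leave `Ω`: run backwards from an exterior point, it would stay put. -/
theorem flow_of_notMem (s t : ℝ) {x : Euc n} (hx : x ∉ Ω) : hV.flow v s t x = x := by
  refine ((hV.isC1Family.isCaratheodory (integrable_velocityExt v)).eq_flow
    (γ := fun _ => x) ?_ s t).symm
  have h0 : ∀ r, extendedField ev (velocityExt v r) x = 0 := fun r =>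
    extendZero_of_notMem _ hx
  simp only [h0]
  exact ⟨integrable_zero _ _ _, fun s t => by simp⟩

theorem flow_flow (r s t : ℝ) (x : Euc n) : hV.flow v s t (hV.flow v r s x) = hV.flow v r t x :=
  hV.isC1Family.flow_flow _ r s t x

@[simp]
theorem flow_self (t : ℝ) (x : Euc n) : hV.flow v t t x = x := hV.isC1Family.flow_self _ t x

theorem flow_mem (s t : ℝ) {x : Euc n} (hx : x ∈ Ω) : hV.flow v s t x ∈ Ω := by
  by_contra h
  have h1 := hV.flow_of_notMem v t s h
  rw [flow_flow, flow_self] at h1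
  rw [← h1] at h
  exact h hx

/-- The diffeomorphism of `Ω` given by the flow from time `0` to time `t`. -/
def diffeo (t : I) : Diffeo Ω where
  toEquiv :=
    { toFun := fun x => ⟨hV.flow v 0 t x, hV.flow_mem v 0 t x.2⟩
      invFun := fun x => ⟨hV.flow v t 0 x, hV.flow_mem v t 0 x.2⟩
      left_inv := fun x => Subtype.ext (by simp [flow_flow])
      right_inv := fun x => Subtype.ext (by simp [flow_flow]) }
  isC1 := isC1_of_contDiff
    (hV.isC1Family.contDiff_flow (integrable_velocityExt v) 0 t) fun _ => rfl
  isC1_symm := isC1_of_contDiff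
    (hV.isC1Family.contDiff_flow (integrable_velocityExt v) t 0) fun _ => rfl

theorem diffeo_apply (t : I) (x : Ω) : ((hV.diffeo v t).toEquiv x : Euc n) = hV.flow v 0 t x := rfl

theorem isFlow_diffeo : IsFlow ev v (hV.diffeo v) := by
  intro x
  have hp := hV.isC1Family.isPrimitive_flow (integrable_velocityExt v) 0 (x : Euc n)
  let H : ℝ → Euc n := fun s => extendedField ev (velocityExt v s) (hV.flow v 0 s x)
  have hH : ∀ s : I, H s = ev (v s) ((hV.diffeo v s).toEquiv x) := fun s => by
    simp only [H]
    rw [velocityExt_coe, extendedField_apply, ← diffeo_apply, extendZero_coe]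
  refine ⟨(integrableOn_unitInterval_iff hH).1 hp.1.integrableOn, fun t => ?_⟩
  rw [setIntegral_Iic_eq hH t, diffeo_apply]
  have := hp.eq_add 0 (t : ℝ)
  simp only [IsC1Family.flow_self] at this
  exact this

/-- A flow on `[0,1]`, frozen outside, solves the extended equation on the real line, where
solutions are unique. -/
theorem eq_diffeo {φ : I → Diffeo Ω} (hφ : IsFlow ev v φ) : φ = hV.diffeo v := by
  funext t
  refine Diffeo.ext fun x => Subtype.ext ?_
  obtain ⟨hint, heq⟩ := hφ x
  let γ : ℝ → Euc n := fun t => (φ (projIcc 0 1 zero_le_one t)).toEquiv x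
  let H : ℝ → Euc n := fun s => extendedField ev (velocityExt v s) (γ s)
  have hγ : ∀ s : I, γ s = (φ s).toEquiv x := fun s => by simp only [γ, projIcc_val]
  have hH : ∀ s : I, H s = ev (v s) ((φ s).toEquiv x) := fun s => by
    simp only [H, hγ, velocityExt_coe, extendedField_apply, extendZero_coe]
  have h0 : ∀ s ∉ Icc (0 : ℝ) 1, H s = 0 := fun s hs => by
    simp only [H, velocityExt_of_notMem _ hs, map_zero, Pi.zero_apply]
  have hHi : Integrable H := integrable_of_zero_off ((integrableOn_unitInterval_iff hH).2 hint) h0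
  have hp : IsPrimitive γ H := isPrimitive_of_eq hHi (x := (x : Euc n)) (t₀ := 0) fun t => by
    rw [intervalIntegral_projIcc hHi h0 t, ← setIntegral_Iic_eq hH]
    exact heq _
  have h1 := (hV.isC1Family.isCaratheodory (integrable_velocityExt v)).eq_flow hp 0 t
  have h2 : γ 0 = x := by
    have := hp.eq_add 0 0
    have h3 := heq 0
    rw [setIntegral_Iic_eq hH] at h3
    rw [← hγ 0] at h3
    simpa using h3
  rw [h2, hγ] at h1
  exact h1

include hV in
theorem existsUnique_isFlow : ∃! φ : I → Diffeo Ω, IsFlow ev v φ :=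
  ⟨hV.diffeo v, hV.isFlow_diffeo v, fun _ h => hV.eq_diffeo v h⟩

theorem flow_projIcc (t : ℝ) (x : Euc n) :
    hV.flow v 0 t x = hV.flow v 0 (projIcc 0 1 zero_le_one t : I) x := by
  have hp := hV.isC1Family.isPrimitive_flow (integrable_velocityExt v) 0 x
  change hV.isC1Family.flow _ 0 t x = hV.isC1Family.flow _ 0 _ x
  rw [hp.eq_add 0 t, hp.eq_add 0 (projIcc 0 1 zero_le_one t : I),
    intervalIntegral_projIcc hp.1 (fun s hs => ?_) t]
  rw [velocityExt_of_notMem _ hs, map_zero, Pi.zero_apply]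

/-! ### First-order equations along the flow -/

/-- The equation `∂ₜ f + ⟨∇f, v⟩ + f q(Dv) = 0` in the Carathéodory sense. -/
def _root_.LDDMM.FirstOrderEquation (ev : V →ₗ[ℝ] (Ω → Euc n))
    (q : (Euc n →L[ℝ] Euc n) →L[ℝ] ℝ) (f : I → Ω → ℝ) (v : Velocity V) : Prop :=
  ∀ x : Ω,
    Integrable (fun s : I => jac (f s) x (ev (v s) x) + f s x * q (jac (ev (v s)) x)) ∧
    ∀ t : I, f t x = f 0 x -
      ∫ s in Iic t, (jac (f s) x (ev (v s) x) + f s x * q (jac (ev (v s)) x))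

/-- The coefficient `q(Dv)` along the trajectory of `y`. -/
def coeff (q : (Euc n →L[ℝ] Euc n) →L[ℝ] ℝ) (y : Euc n) (r : ℝ) : ℝ :=
  q (fderiv ℝ (extendedField ev (velocityExt v r)) (hV.flow v 0 r y))

theorem integrable_coeff (q : (Euc n →L[ℝ] Euc n) →L[ℝ] ℝ) (y : Euc n) :
    Integrable (hV.coeff v q y) :=
  q.integrable_comp (hV.isC1Family.integrable_fderiv (integrable_velocityExt v)
    (hV.isC1Family.continuous_flow_time _ 0 y))

theorem coeff_of_notMem (q : (Euc n →L[ℝ] Euc n) →L[ℝ] ℝ) (y : Euc n) {r : ℝ}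
    (hr : r ∉ Icc (0 : ℝ) 1) : hV.coeff v q y r = 0 := by
  have h1 := hV.isC1Family.norm_fderiv_le 0 (hV.flow v 0 r y)
  rw [norm_zero, mul_zero, norm_le_zero_iff] at h1
  rw [coeff, velocityExt_of_notMem _ hr, h1, map_zero]

/-- Time is frozen outside `[0,1]`. Joint continuity passes from `ℝ × Ω` to the ambient space
because the inclusion is an open embedding, and from the gradient to the derivative by the Riesz
isometry. -/
theorem _root_.LDDMM.IsC1Trajectory.isC1InSpace {f : I → Ω → ℝ} (hf : IsC1Trajectory f)
    (hC1 : ∀ t, IsC1 (f t)) :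
    IsC1InSpace (Ω : Set (Euc n)) (fun t => extendZero (f (projIcc 0 1 zero_le_one t)))
      (fun t => fderiv ℝ (extendZero (f (projIcc 0 1 zero_le_one t)))) := by
  have hj : IsOpenEmbedding (Prod.map id (↑) : ℝ × Ω → ℝ × Euc n) :=
    IsOpenEmbedding.id.prodMap Ω.isOpen.isOpenEmbedding_subtypeVal
  have hproj : Continuous (fun p : ℝ × Ω => (projIcc (0 : ℝ) 1 zero_le_one p.1, p.2)) :=
    (continuous_projIcc.comp continuous_fst).prodMk continuous_snd
  refine ⟨fun t x hx => (hC1 _).hasFDerivAt ⟨x, hx⟩, fun p hp => ?_, fun p hp => ?_⟩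
  · refine (hj.continuousAt_iff (x := (p.1, (⟨p.2, hp⟩ : Ω)))
      (g := fun p : ℝ × Euc n => extendZero (f (projIcc 0 1 zero_le_one p.1)) p.2)).1 ?_
    refine ((hf.1.comp hproj).congr fun q => ?_).continuousAt
    exact (extendZero_coe _ q.2).symm
  · refine (hj.continuousAt_iff (x := (p.1, (⟨p.2, hp⟩ : Ω)))
      (g := fun p : ℝ × Euc n => fderiv ℝ (extendZero (f (projIcc 0 1 zero_le_one p.1))) p.2)).1 ?_
    refine (((InnerProductSpace.toDual ℝ (Euc n)).continuous.comp
      (hf.2.comp hproj)).congr fun q => ?_).continuousAt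
    simp [grad, gradient]

/-- A `C¹` trajectory solves the first-order equation if and only if its values along the flow
satisfy the corresponding linear ordinary differential equation. -/
theorem firstOrderEquation_iff (q : (Euc n →L[ℝ] Euc n) →L[ℝ] ℝ) {f : I → Ω → ℝ}
    (hf : IsC1Trajectory f) (hC1 : ∀ t, IsC1 (f t)) :
    FirstOrderEquation ev q f v ↔ ∀ (y : Ω) (t : I), f t ((hV.diffeo v t).toEquiv y) =
      f 0 y * Real.exp (∫ r in (0 : ℝ)..t, -hV.coeff v q y r) := by
  have hfam := hV.isC1Family
  have hv := integrable_velocityExt v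
  have hS := hf.isC1InSpace hC1
  set g : ℝ → Euc n → ℝ := fun t => extendZero (f (projIcc 0 1 zero_le_one t)) with hg
  have hgI : ∀ (s : I) (x : Ω), g s x = f s x := fun s x => by
    simp only [hg, projIcc_val, extendZero_coe]
  have hg0 : ∀ x : Ω, g 0 x = f 0 x := hgI 0
  have hflow : ∀ s t, ∀ x ∈ (Ω : Set (Euc n)), hfam.flow hv s t x ∈ (Ω : Set (Euc n)) :=
    fun s t x hx => hV.flow_mem v s t hx
  let H : Ω → ℝ → ℝ := fun x r => fderiv ℝ (g r) x (extendedField ev (velocityExt v r) x) +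
    g r x * q (fderiv ℝ (extendedField ev (velocityExt v r)) x)
  have hH : ∀ (x : Ω) (s : I), H x s =
      jac (f s) x (ev (v s) x) + f s x * q (jac (ev (v s)) x) := fun x s => by
    simp only [H, hgI, velocityExt_coe, extendedField_apply, extendZero_coe]
    simp only [hg, projIcc_val, jac]
  have hlag : ∀ (y : Ω) (t : I), g t (hV.flow v 0 t y) = f t ((hV.diffeo v t).toEquiv y) :=
    fun y t => hgI t ((hV.diffeo v t).toEquiv y)
  constructor
  · intro heq y t
    have heul : ∀ x ∈ (Ω : Set (Euc n)), ∀ t ∈ Icc (0 : ℝ) 1, g t x = g 0 x - ∫ r in (0 : ℝ)..t,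
        (fderiv ℝ (g r) x (extendedField ev (velocityExt v r) x) +
          g r x * q (fderiv ℝ (extendedField ev (velocityExt v r)) x)) := by
      intro x hx t ht
      have h1 := (heq ⟨x, hx⟩).2 ⟨t, ht⟩
      rw [setIntegral_Iic_eq (hH ⟨x, hx⟩), ← hgI, ← hg0] at h1
      exact h1
    -- `G` is constant outside `[0,1]`, hence bounded, and the Lagrangian form makes it a primitive
    -- of `-coeff * G` on the whole line; `eq_mul_exp` then solves for it.
    let G : ℝ → ℝ := fun t => g t (hV.flow v 0 t y)
    have hG : ∀ t, G t = G (projIcc 0 1 zero_le_one t : I) := fun t => by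
      simp only [G, hV.flow_projIcc v t]
      simp only [hg, projIcc_val]
    have hGc : Continuous G := hS.continuous_comp (hfam.continuous_flow_time hv 0 (y : Euc n))
      fun t => hV.flow_mem v 0 t y.2
    obtain ⟨M, hM⟩ := (isCompact_Icc (a := (0 : ℝ)) (b := 1)).exists_bound_of_continuousOn
      hGc.continuousOn
    have hGi : Integrable (fun r => -hV.coeff v q y r * G r) :=
      (hV.integrable_coeff v q y).neg.mul_bdd (c := M) hGc.aestronglyMeasurable
        (Eventually.of_forall fun t => by
          rw [hG]; exact hM _ (projIcc (0 : ℝ) 1 zero_le_one t).2)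
    have hGp : IsPrimitive G (fun r => -hV.coeff v q y r * G r) := by
      refine isPrimitive_of_eq hGi (x := G 0) (t₀ := 0) fun t => ?_
      rw [hG t, intervalIntegral_projIcc hGi (fun r hr => by
        rw [hV.coeff_of_notMem v q y hr, neg_zero, zero_mul]) t]
      have h1 := hfam.lagrangian_of_eulerian hv q Ω.isOpen hS hflow heul y.2
        (projIcc (0 : ℝ) 1 zero_le_one t).2
      have h2 : G 0 = g 0 y := by simp only [G, flow_self]
      rw [h2, show G (projIcc 0 1 zero_le_one t : I) = _ from h1, sub_eq_add_neg,
        ← intervalIntegral.integral_neg]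
      congr 1
      refine intervalIntegral.integral_congr fun r _ => ?_
      simp only [G, coeff, flow]
      ring
    have h1 := hGp.eq_mul_exp (hV.integrable_coeff v q y).neg 0 (t : ℝ)
    have h2 : G 0 = f 0 y := by simp only [G, flow_self, hg0]
    rw [h2] at h1
    rw [← hlag]
    exact h1
  · intro hexp x
    have hi : IntervalIntegrable (H x) volume 0 1 :=
      (hfam.intervalIntegrable_transport hv hS x.2 0 1).add
        (hfam.intervalIntegrable_reaction hv q hS (continuous_const (y := (x : Euc n)))
          (fun _ => x.2) 0 1)
    refine ⟨(integrableOn_unitInterval_iff (hH x)).1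
      ((intervalIntegrable_iff_integrableOn_Icc_of_le zero_le_one).1 hi), fun t => ?_⟩
    rw [setIntegral_Iic_eq (hH x), ← hgI, ← hg0]
    refine hfam.eulerian_of_lagrangian hv q Ω.isOpen hS hflow (fun y hy s t' hs hst ht => ?_)
      x.2 t.2.1
    -- Conversely, increments of the exponential formula are exactly the Lagrangian form of the
    -- equation.
    have hp := isPrimitive_exp (hV.integrable_coeff v q y).neg (f 0 ⟨y, hy⟩) 0
    have hval : ∀ r ∈ Icc (0 : ℝ) 1, g r (hV.flow v 0 r y) =
        f 0 ⟨y, hy⟩ * Real.exp (∫ r in (0 : ℝ)..r, -hV.coeff v q y r) := fun r hr =>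
      (hlag ⟨y, hy⟩ ⟨r, hr⟩).trans (hexp ⟨y, hy⟩ ⟨r, hr⟩)
    have h1 := hp.2 s t'
    simp only [Pi.neg_apply] at h1
    have ht1 : t' ≤ 1 := ht.trans t.2.2
    rw [← hval t' ⟨hs.trans hst, ht1⟩, ← hval s ⟨hs, hst.trans ht1⟩] at h1
    rw [← intervalIntegral.integral_neg]
    refine h1.trans (intervalIntegral.integral_congr fun r hr => ?_)
    rw [uIcc_of_le hst] at hr
    rw [← hval r ⟨hs.trans hr.1, hr.2.trans ht1⟩]
    simp only [coeff, flow]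
    ring

end IsAdmissible

end AdmissibleFlow

section Equivalence

variable {n : ℕ} {Ω : TopologicalSpace.Opens (Euc n)}
  {V : Type*} [NormedAddCommGroup V] [InnerProductSpace ℝ V]
  {ev : V →ₗ[ℝ] (Ω → Euc n)}

/-! ### Transport and continuity equations as first-order equations -/

theorem inner_grad (f : Ω → ℝ) (x : Ω) (w : Euc n) : inner ℝ (grad f x) w = jac f x w := by
  rw [grad, gradient, InnerProductSpace.toDual_symm_apply, jac]

theorem transportEquation_iff (f : I → Ω → ℝ) (v : Velocity V) :
    TransportEquation ev f v ↔ FirstOrderEquation ev 0 f v := by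
  simp only [TransportEquation, FirstOrderEquation, inner_grad, zero_apply, mul_zero, add_zero]

/-- The trace as a continuous linear functional. -/
def traceCLM (n : ℕ) : (Euc n →L[ℝ] Euc n) →L[ℝ] ℝ :=
  LinearMap.toContinuousLinearMap (LinearMap.trace ℝ (Euc n) ∘ₗ ContinuousLinearMap.coeLM ℝ)

theorem traceCLM_apply (A : Euc n →L[ℝ] Euc n) :
    traceCLM n A = LinearMap.trace ℝ (Euc n) (A : Euc n →ₗ[ℝ] Euc n) := rfl

/-- Product rule, where the rank-one part `w ↦ Df(w) u` of the Jacobian has trace `Df(u)`. -/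
theorem divergence_smul {f : Ω → ℝ} {u : Ω → Euc n} (hf : IsC1 f) (hu : IsC1 u) (x : Ω) :
    divergence (fun y => f y • u y) x = jac f x (u x) + f x * traceCLM n (jac u x) := by
  have h1 : extendZero (fun y => f y • u y) =ᶠ[𝓝 (x : Euc n)]
      fun y => extendZero f y • extendZero u y :=
    extendZero_eventuallyEq (fun y => by simp only [extendZero_coe]) x.2
  have h2 := ((hf.hasFDerivAt x).smul (hu.hasFDerivAt x)).congr_of_eventuallyEq h1
  rw [divergence, jac, h2.fderiv, extendZero_coe, extendZero_coe, ← traceCLM_apply, map_add,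
    map_smul, smul_eq_mul, add_comm]
  congr 1
  exact LinearMap.trace_smulRight _ _

theorem continuityEquation_iff (hV : IsAdmissible ev) {f : I → Ω → ℝ} (hf : ∀ t, IsC1 (f t))
    (v : Velocity V) :
    ContinuityEquation ev f v ↔ FirstOrderEquation ev (traceCLM n) f v := by
  have h : ∀ (s : I) (x : Ω), divergence (fun y => f s y • ev (v s) y) x =
      jac (f s) x (ev (v s) x) + f s x * traceCLM n (jac (ev (v s)) x) := fun s x =>
    divergence_smul (hf s) (hV.isC1Zero _).1 x
  simp only [ContinuityEquation, FirstOrderEquation, h]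

/-! ### The actions along the flow -/

namespace IsAdmissible

variable (hV : IsAdmissible ev) (v : Velocity V)

theorem geometricAction_diffeo (T : Ω → ℝ) (t : I) (y : Ω) :
    geometricAction (hV.diffeo v t) T ((hV.diffeo v t).toEquiv y) =
      T y * Real.exp (∫ r in (0 : ℝ)..t, -hV.coeff v 0 y r) := by
  simp [geometricAction, coeff]

/-- Liouville's formula for the backward flow started at `φₜ(y)`: it retraces the trajectory of `y`,
so reversing the integral produces the minus sign. -/
theorem massAction_diffeo (T : Ω → ℝ) (t : I) (y : Ω) :
    massAction (hV.diffeo v t) T ((hV.diffeo v t).toEquiv y) =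
      T y * Real.exp (∫ r in (0 : ℝ)..t, -hV.coeff v (traceCLM n) y r) := by
  have hfam := hV.isC1Family
  have hv := integrable_velocityExt v
  have h1 : jac (fun y => ((hV.diffeo v t).toEquiv.symm y : Euc n)) ((hV.diffeo v t).toEquiv y) =
      hfam.flowDeriv hv t 0 (hfam.flow hv 0 t y) :=
    ((hfam.hasFDerivAt_flow hv t 0 _).congr_of_eventuallyEq
      (extendZero_eventuallyEq (fun _ => rfl) ((hV.diffeo v t).toEquiv y).2)).fderiv
  rw [massAction, h1, hfam.det_flowDeriv, Equiv.symm_apply_apply, mul_comm,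
    intervalIntegral.integral_symm, ← intervalIntegral.integral_neg]
  simp only [IsC1Family.flow_flow]
  rfl

/-- Chain rule with the jointly continuous backward flow and its derivative. The mass-preserving
action has no analogue: the gradient of its determinant would involve second derivatives of the
flow. -/
theorem isC1Trajectory_geometric {T : Ω → ℝ} (hT : IsC1 T) :
    IsC1Trajectory (orbit geometricAction T (hV.diffeo v)) := by
  have hfam := hV.isC1Family
  have hv := integrable_velocityExt v
  have hemb : Continuous (fun p : I × Ω => ((p.1 : ℝ), (p.2 : Euc n))) := by fun_prop
  have hψ₀ := (hfam.continuous_flow_symm hv 0).comp hemb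
  have hψ : Continuous (fun p : I × Ω => (hV.diffeo v p.1).toEquiv.symm p.2) :=
    continuous_induced_rng.2 hψ₀
  refine ⟨hT.continuous.comp hψ, ?_⟩
  have hZ := (hfam.continuous_flowDeriv_symm hv 0).comp hemb
  have hJ : Continuous (fun p : I × Ω => jac T ((hV.diffeo v p.1).toEquiv.symm p.2)) :=
    hT.continuous_jac.comp hψ
  have hD : Continuous (fun p : I × Ω => (InnerProductSpace.toDual ℝ (Euc n)).symm
      (jac T ((hV.diffeo v p.1).toEquiv.symm p.2) ∘L hfam.flowDeriv hv p.1 0 p.2)) :=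
    (InnerProductSpace.toDual ℝ (Euc n)).symm.continuous.comp (hJ.clm_comp hZ)
  refine hD.congr fun p => ?_
  have h1 : HasFDerivAt (extendZero (orbit geometricAction T (hV.diffeo v) p.1))
      (jac T ((hV.diffeo v p.1).toEquiv.symm p.2) ∘L hfam.flowDeriv hv p.1 0 p.2) p.2 := by
    have h2 : HasFDerivAt (extendZero T) (jac T ((hV.diffeo v p.1).toEquiv.symm p.2))
        (hfam.flow hv p.1 0 p.2) := hT.hasFDerivAt ((hV.diffeo v p.1).toEquiv.symm p.2)
    refine (h2.comp (p.2 : Euc n) (hfam.hasFDerivAt_flow hv p.1 0 p.2)).congr_of_eventuallyEq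
      (extendZero_eventuallyEq (fun x => ?_) p.2.2)
    exact (extendZero_coe T ((hV.diffeo v p.1).toEquiv.symm x)).symm
  rw [grad, gradient, h1.fderiv]

/-! ### Equivalence of the two problems -/

variable {Y : Type*} {X : Submodule ℝ (Ω → ℝ)}
  (D : Y → Y → ℝ≥0) (A : I → (Ω → ℝ) → Y) (g : I → Y) (R₁ : (Ω → ℝ) → ℝ≥0) (μ₁ μ₂ : ℝ≥0)

/-- `hact` and `firstOrderEquation_iff` prescribe the same values along trajectories, and `φₜ` is
onto `Ω`, so solutions of the equation and orbits coincide. Uniqueness of the flow removes `φ` from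
the unknowns of the joint model. -/
theorem areEquivalent (hX : ∀ T ∈ X, IsC1 T) {act : Diffeo Ω → (Ω → ℝ) → (Ω → ℝ)}
    {pde : (I → Ω → ℝ) → Velocity V → Prop} (q : (Euc n →L[ℝ] Euc n) →L[ℝ] ℝ)
    (hact : ∀ (v : Velocity V) (T : Ω → ℝ) (t : I) (y : Ω),
      act (hV.diffeo v t) T ((hV.diffeo v t).toEquiv y) =
        T y * Real.exp (∫ r in (0 : ℝ)..t, -hV.coeff v q y r))
    (hpde : ∀ f v, (∀ t, IsC1 (f t)) → (pde f v ↔ FirstOrderEquation ev q f v))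
    (horb : ∀ (v : Velocity V), ∀ T ∈ X, (∀ t, orbit act T (hV.diffeo v) t ∈ X) ∧
      IsC1Trajectory (orbit act T (hV.diffeo v))) :
    AreEquivalent act (jointModel ev X D A g R₁ μ₁ μ₂ act) (pdeProblem X D A g R₁ μ₁ μ₂ pde) := by
  set P := jointModel ev X D A g R₁ μ₁ μ₂ act
  set Q := pdeProblem X D A g R₁ μ₁ μ₂ pde
  have hzero : ∀ (v : Velocity V) T, orbit act T (hV.diffeo v) 0 = T := by
    intro v T
    funext y
    have h1 : (hV.diffeo v 0).toEquiv y = y := Subtype.ext (hV.flow_self v 0 y)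
    have h2 := hact v T 0 y
    rw [h1] at h2
    simpa [orbit] using h2
  have heq : ∀ (v : Velocity V) (f : I → Ω → ℝ) T, (∀ (y : Ω) (t : I),
      f t ((hV.diffeo v t).toEquiv y) = T y * Real.exp (∫ r in (0 : ℝ)..t, -hV.coeff v q y r)) →
      f = orbit act T (hV.diffeo v) := by
    intro v f T h
    funext t x
    have h1 := hact v T t ((hV.diffeo v t).toEquiv.symm x)
    have h2 := h ((hV.diffeo v t).toEquiv.symm x) t
    rw [Equiv.apply_symm_apply] at h1 h2
    rw [h2, ← h1]
    rfl
  have hPQ : ∀ (v : Velocity V), ∀ T ∈ X, (orbit act T (hV.diffeo v), v) ∈ Q.feasible := by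
    intro v T hT
    obtain ⟨hmem, htraj⟩ := horb v T hT
    refine ⟨hmem, htraj, (hpde _ v fun t => hX _ (hmem t)).2 ?_⟩
    refine (hV.firstOrderEquation_iff v q htraj fun t => hX _ (hmem t)).2 fun y t => ?_
    rw [hzero]
    exact hact v T t y
  have hQP : ∀ f v, (f, v) ∈ Q.feasible → f 0 ∈ X ∧ f = orbit act (f 0) (hV.diffeo v) := by
    rintro f v ⟨hmem, htraj, heqn⟩
    refine ⟨hmem 0, heq v f (f 0) ?_⟩
    exact (hV.firstOrderEquation_iff v q htraj fun t => hX _ (hmem t)).1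
      ((hpde f v fun t => hX _ (hmem t)).1 heqn)
  have hobj : ∀ v T, Q.objective (orbit act T (hV.diffeo v), v) =
      P.objective (T, v, hV.diffeo v) := by
    intro v T
    simp only [Q, P, pdeProblem, jointModel, hzero]
  have hPfeas : ∀ v, ∀ T ∈ X, (T, v, hV.diffeo v) ∈ P.feasible := fun v T hT =>
    ⟨hT, hV.isFlow_diffeo v⟩
  refine ⟨⟨?_, ?_, ?_⟩, ?_, le_antisymm ?_ ?_, ?_, ?_⟩
  · rintro ⟨T, v, φ⟩ ⟨hT, hφ⟩
    obtain rfl := hV.eq_diffeo v hφ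
    exact hPQ v T hT
  · rintro ⟨T₁, v₁, φ₁⟩ ⟨hT₁, hφ₁⟩ ⟨T₂, v₂, φ₂⟩ ⟨hT₂, hφ₂⟩ h
    obtain ⟨h1, rfl⟩ := Prod.mk.inj h
    obtain rfl := hV.eq_diffeo v₁ hφ₁
    obtain rfl := hV.eq_diffeo v₁ hφ₂
    have h2 := congrFun h1 0
    simp only [hzero] at h2
    rw [h2]
  · rintro ⟨f, v⟩ hf
    obtain ⟨h0, h1⟩ := hQP f v hf
    exact ⟨(f 0, v, hV.diffeo v), hPfeas v _ h0, Prod.ext h1.symm rfl⟩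
  · rintro T v φ ⟨hT, hφ⟩
    obtain rfl := hV.eq_diffeo v hφ
    exact ⟨hzero v T, hobj v T⟩
  · refine le_iInf₂ fun p hp => ?_
    obtain ⟨f, v⟩ := p
    obtain ⟨h0, h1⟩ := hQP f v hp
    rw [h1, hobj]
    exact iInf₂_le _ (hPfeas v _ h0)
  · refine le_iInf₂ fun p hp => ?_
    obtain ⟨T, v, φ⟩ := p
    obtain rfl := hV.eq_diffeo v hp.2
    rw [← hobj]
    exact iInf₂_le _ (hPQ v T hp.1)
  · rintro T v φ ⟨⟨hT, hφ⟩, hmin⟩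
    obtain rfl := hV.eq_diffeo v hφ
    refine ⟨hPQ v T hT, ?_⟩
    rintro ⟨f, w⟩ hf
    obtain ⟨h0, h1⟩ := hQP f w hf
    rw [hobj, h1, hobj]
    exact hmin _ (hPfeas w _ h0)
  · rintro f v ⟨hf, hmin⟩
    obtain ⟨h0, h1⟩ := hQP f v hf
    refine ⟨hV.diffeo v, ⟨hPfeas v _ h0, ?_⟩, h1⟩
    rintro ⟨T, w, φ⟩ ⟨hT, hφ⟩
    obtain rfl := hV.eq_diffeo w hφ
    rw [← hobj, ← hobj, ← h1]
    exact hmin _ (hPQ w T hT)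

end IsAdmissible

end Equivalence

end LDDMM

end

theorem mainTheorem1 {n : ℕ} (Ω : TopologicalSpace.Opens (Euc n))
    {V : Type*} [NormedAddCommGroup V] [InnerProductSpace ℝ V] [CompleteSpace V]
    (ev : V →ₗ[ℝ] (Ω → Euc n)) (hV : IsAdmissible ev)
    (X : Submodule ℝ (Ω → ℝ)) (hX : ∀ T ∈ X, IsC1 T)
    {Y : Type*} (D : Y → Y → ℝ≥0) (A : I → (Ω → ℝ) → Y) (g : I → Y)
    (R₁ : (Ω → ℝ) → ℝ≥0) (μ₁ μ₂ : ℝ≥0) :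
    (∀ v : Velocity V, ∃! φ : I → Diffeo Ω, IsFlow ev v φ) ∧
    ((∀ (v : Velocity V) (φ : I → Diffeo Ω), IsFlow ev v φ → ∀ T ∈ X, ∀ t,
        orbit geometricAction T φ t ∈ X) →
      AreEquivalent geometricAction
        (jointModel ev X D A g R₁ μ₁ μ₂ geometricAction)
        (pdeProblem X D A g R₁ μ₁ μ₂ (TransportEquation ev))) ∧
    ((∀ (v : Velocity V) (φ : I → Diffeo Ω), IsFlow ev v φ → ∀ T ∈ X,
        (∀ t, orbit massAction T φ t ∈ X) ∧ IsC1Trajectory (orbit massAction T φ)) →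
      AreEquivalent massAction
        (jointModel ev X D A g R₁ μ₁ μ₂ massAction)
        (pdeProblem X D A g R₁ μ₁ μ₂ (ContinuityEquation ev))) := by
  refine ⟨hV.existsUnique_isFlow, fun hgeo => ?_, fun hmass => ?_⟩
  -- Regularity of the geometric orbit is proved; for the mass-preserving action it is part of
  -- `hmass`.
  · exact hV.areEquivalent D A g R₁ μ₁ μ₂ hX 0 hV.geometricAction_diffeo
      (fun f v _ => transportEquation_iff f v) fun v T hT =>
        ⟨hgeo v _ (hV.isFlow_diffeo v) T hT, hV.isC1Trajectory_geometric v (hX T hT)⟩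
  · exact hV.areEquivalent D A g R₁ μ₁ μ₂ hX (traceCLM n) hV.massAction_diffeo
      (fun f v hf => continuityEquation_iff hV hf v) fun v T hT =>
        hmass v _ (hV.isFlow_diffeo v) T hT
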